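/- Theorem (hardest distributions for MAX NAE-$\{3\}$-SAT). Setting. A triple of pairwise biases is a triple $b=(b_{12},b_{13},b_{23})\in\mathbb R^3$ of the form $b_{ij}=\mathbb E[x_ix_j]$ for some probability distribution on assignments $(x_1,x_2,x_3)\in\{-1,1\}^3$; the contribution of a clause with these biases to the SDP value is then $\mathbb E[\mathrm{NAE}_3(x_1,x_2,x_3)]=\frac{3-b_{12}-b_{13}-b_{23}}{4}$. A Borel probability measure $\mathcal D$ on such triples has completeness $c$ if $\mathbb E_{b\sim\mathcal D}\big[\frac{3-b_{12}-b_{13}-b_{23}}4\big]=c$. A rounding function is an odd measurable $f:\mathbb R^d\to[-1,1]$, $d\ge 0$. For $\rho\in[-1,1]$ let $F_2[f](\rho)=\mathbb E[f(u)f(v)]$ where $u,v$ are $\rho$-correlated standard Gaussian vectors in $\mathbb R^d$. The performance of $f$ on $\mathcal D$ is \[ s_3(f,\mathcal D)=\frac{3-\mathbb E_{b\sim\mathcal D}\big[F_2[f](b_{12})+F_2[f](b_{13})+F_2[f](b_{23})\big]}{4}, \] and $\mathcal D$ is hardest for $f$ at completeness $c$ if it has completeness $c$ and minimizes $s_3(f,\cdot)$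 among all distributions with completeness $c$. Say that $\mathcal D$ is of hard form if it is supported on one of 1. $\{(-\rho,-\rho,-\rho),(-\rho,-\rho,1)\}$ for some $\rho\in[0,\frac13]$; 2. $\{(-\frac13,-\frac13,-\frac13),(-\rho,-\rho,1)\}$ for some $\rho\in[\frac13,1]$; 3. $\{(-\rho,-\rho,1),(1,1,1)\}$ for some $\rho\in[-1,1]$. Statement. Let $c\in[0,1]$. (i) For every distribution $\mathcal D$ with completeness $c$ there is a distribution $\mathcal D'$ of hard form with completeness $c$ such that $s_3(f,\mathcal D')\le s_3(f,\mathcal D)$ for all rounding functions $f$ (of all dimensions) simultaneously. (ii) For every rounding function $f$ there is a distribution of hard form that is hardest for $f$ at completeness $c$. (iii) For every rounding function $f$ that is not almost everywhere $0$, each distribution $\mathcal D$ that is hardest for $f$ at completeness $c$ is equivalent to one of hard form: there is $\mathcal D'$ of hard form with completeness $c$ and $s_3(g,\mathcal D')=s_3(g,\mathcal D)$ for all rounding functions $g$. -/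

import Mathlib

open MeasureTheory ProbabilityTheory

noncomputable section

namespace NAE3

/-- The predicate `NAE₃` on `{-1, 1}³`, with real value `0` or `1`. -/
def nae (x : Fin 3 → ℤˣ) : ℝ := if x 0 = x 1 ∧ x 1 = x 2 then 0 else 1

/-- `p` is a probability distribution on assignments to the three variables of a clause whose
pairwise correlations are `b = (b₁₂, b₁₃, b₂₃)` (the local constraints of the Basic SDP). -/
def IsLocalDistribution (p : (Fin 3 → ℤˣ) → ℝ) (b : ℝ × ℝ × ℝ) : Prop :=
  (∀ x, 0 ≤ p x) ∧ ∑ x, p x = 1 ∧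
    ∑ x, p x * ((x 0 : ℤ) * (x 1 : ℤ) : ℝ) = b.1 ∧
    ∑ x, p x * ((x 0 : ℤ) * (x 2 : ℤ) : ℝ) = b.2.1 ∧
    ∑ x, p x * ((x 1 : ℤ) * (x 2 : ℤ) : ℝ) = b.2.2

/-- The possible triples `(b₁₂, b₁₃, b₂₃)` of pairwise biases of a clause. -/
def biasTriples : Set (ℝ × ℝ × ℝ) := {b | ∃ p, IsLocalDistribution p b}

/-- The contribution of a clause with pairwise biases `b` to the SDP value. -/
def sdpValue (b : ℝ × ℝ × ℝ) : ℝ := (3 - b.1 - b.2.1 - b.2.2) / 4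

/-- The SDP contribution of a clause, `∑ p(α) NAE₃(α)`, is `sdpValue b` for every
local distribution `p` that matches the pairwise biases `b`. -/
theorem sum_nae_eq_sdpValue {p : (Fin 3 → ℤˣ) → ℝ} {b : ℝ × ℝ × ℝ}
    (h : IsLocalDistribution p b) : ∑ x, p x * nae x = sdpValue b := by
  obtain ⟨-, h1, h2, h3, h4⟩ := h
  have key : ∀ x : Fin 3 → ℤˣ, nae x = (3 - ((x 0 : ℤ) * (x 1 : ℤ) : ℝ)
      - ((x 0 : ℤ) * (x 2 : ℤ) : ℝ) - ((x 1 : ℤ) * (x 2 : ℤ) : ℝ)) / 4 := by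
    intro x
    unfold nae
    rcases Int.units_eq_one_or (x 0) with h0 | h0 <;>
    rcases Int.units_eq_one_or (x 1) with h1 | h1 <;>
    rcases Int.units_eq_one_or (x 2) with h2 | h2 <;>
    norm_num [h0, h1, h2]
  unfold sdpValue
  rw [← h2, ← h3, ← h4]
  have h1' : (3 : ℝ) = ∑ x, p x * 3 := by rw [← Finset.sum_mul, h1, one_mul]
  rw [h1', ← Finset.sum_sub_distrib, ← Finset.sum_sub_distrib, ← Finset.sum_sub_distrib,
    Finset.sum_div]
  refine Finset.sum_congr rfl fun x _ => ?_
  rw [key]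
  ring

/-- A distribution of triples of pairwise biases. -/
def IsBiasDistribution (D : Measure (ℝ × ℝ × ℝ)) : Prop :=
  IsProbabilityMeasure D ∧ ∀ᵐ b ∂D, b ∈ biasTriples

/-- `D` is a distribution of triples of pairwise biases whose SDP value is `c`. -/
def HasCompleteness (D : Measure (ℝ × ℝ × ℝ)) (c : ℝ) : Prop :=
  IsBiasDistribution D ∧ ∫ b, sdpValue b ∂D = c

/-- The standard Gaussian measure on `ℝᵈ`. -/
def stdGauss (d : ℕ) : Measure (Fin d → ℝ) := Measure.pi fun _ => gaussianReal 0 1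

/-- An odd `d`-dimensional `RPR²` rounding function `f : ℝᵈ → [-1, 1]`. -/
structure IsRounding {d : ℕ} (f : (Fin d → ℝ) → ℝ) : Prop where
  measurable : Measurable f
  mem_Icc : ∀ x, f x ∈ Set.Icc (-1 : ℝ) 1
  odd : ∀ x, f (-x) = -f x

/-- The second moment function `F₂[f](ρ) = 𝔼[f(u) f(v)]`, with `u, v` a pair of `ρ`-correlated
standard Gaussians in `ℝᵈ`: `u = z` and `v = ρ z + √(1 - ρ²) w` are the projections of the unit
vectors `(1, 0)` and `(ρ, √(1 - ρ²))` on `d` independent Gaussian directions of `ℝ²`. -/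
def F₂ {d : ℕ} (f : (Fin d → ℝ) → ℝ) (ρ : ℝ) : ℝ :=
  ∫ q : (Fin d → ℝ) × (Fin d → ℝ), f q.1 * f (ρ • q.1 + √(1 - ρ ^ 2) • q.2)
    ∂((stdGauss d).prod (stdGauss d))

/-- The expected performance of the rounding function `f` on the distribution `D`. -/
def s₃ {d : ℕ} (f : (Fin d → ℝ) → ℝ) (D : Measure (ℝ × ℝ × ℝ)) : ℝ :=
  (3 - ∫ b, (F₂ f b.1 + F₂ f b.2.1 + F₂ f b.2.2) ∂D) / 4

/-- `D` is a hardest distribution for `f` among the distributions with completeness `c`. -/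
def IsHardest {d : ℕ} (f : (Fin d → ℝ) → ℝ) (c : ℝ) (D : Measure (ℝ × ℝ × ℝ)) : Prop :=
  HasCompleteness D c ∧ ∀ D', HasCompleteness D' c → s₃ f D ≤ s₃ f D'

/-- `D` is supported on the set `S`. -/
def SupportedOn (D : Measure (ℝ × ℝ × ℝ)) (S : Set (ℝ × ℝ × ℝ)) : Prop := ∀ᵐ b ∂D, b ∈ S

/-- The three forms of the hardest distributions. -/
def IsHardForm (D : Measure (ℝ × ℝ × ℝ)) : Prop :=
  (∃ ρ ∈ Set.Icc (0 : ℝ) (1 / 3), SupportedOn D {(-ρ, -ρ, -ρ), (-ρ, -ρ, 1)}) ∨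
  (∃ ρ ∈ Set.Icc (1 / 3 : ℝ) 1, SupportedOn D {(-1 / 3, -1 / 3, -1 / 3), (-ρ, -ρ, 1)}) ∨
  (∃ ρ ∈ Set.Icc (-1 : ℝ) 1, SupportedOn D {(-ρ, -ρ, 1), (1, 1, 1)})

end NAE3

end

/-!
Two facts carry the proof.

*Second moment functions are odd power series.* For a rounding function `f`, `F₂ f` equals
`∑ aₙ ρ ^ (2 n + 1)` on `[-1, 1]` with `aₙ ≥ 0` (`IsRounding.exists_isOddSeries`). For a finite
combination of sines `sin (ξ ⬝ x)` this is an explicit Gaussian computation: the covariance of two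
sines is a multiple of `sinh (ρ (ξ ⬝ η))`, and the coefficients are nonnegative because powers of
a Gram matrix are positive semidefinite. Combinations of sines are dense among the odd functions
in `L²`, by injectivity of the characteristic function, and the coefficients pass to the limit by
compactness. The limit also identifies `a₀` as the squared length of the vector `v` of first
moments of `f`. If no other coefficient occurred, `𝔼[f²] = a₀` would force `f = v ⬝ x`, which is
bounded only for `v = 0`; so `F₂ f` is nonlinear unless `f` vanishes almost everywhere
(`IsRounding.exists_coeff_ne_zero`).

*Domination.* For every distribution `D` of bias triples there is a two-point distribution `D'` of
hard form with the same completeness such that `𝔼[h(b₁₂) + h(b₁₃) + h(b₂₃)]` is at least as large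
for `D'` as for `D`, for all odd `h` that are convex on `[0, 1]` at once (`exists_dominating`).
Such an `h` gains when a positive bias is spread to `0` and `1`, and when the negative biases and
the zeros are moved to their mean. So a triple `b` counts only through its total positive part
`P` and its total negative part `N`, and so does `D` through the means of `P` and `N`, which
already determine `D'`. There are two obstructions. The mean negative bias may exceed `1/3`, where
`(-ρ, -ρ, -ρ)` leaves the polytope of bias triples: then `-1/3` is used for the triples without
an entry `1`, which gives the second hard form. Also, triples with `N > 1` have to be replaced
beforehand by a mixture of `(-1/3, -1/3, -1/3)` and `(-N/2, -N/2, 1)`. The pointwise inequalities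
behind this are `OddConvex.tripleSum_le_support` and `OddConvex.tripleSum_le_third`.

Domination for the odd powers gives (i), and (ii) follows since the two-point distributions of
hard form with completeness `c` form a compact family. For (iii), a hardest `D` and its `D'` have
equal integrals of `F₂ f`, hence equal moments of some odd order `k ≥ 3`. The test function
`C x ^ k - x ^ l` turns this into equality for all odd `l ≥ k`, and a power `x ^ (k - 2)` is
a bounded limit of combinations of higher odd powers, so that all odd moments agree
(`moment_eq_of_dominated`). These determine `s₃ g` for every `g`.
-/

noncomputable section

namespace NAE3

section

/-! ### The polytope of bias triples -/

/-- The triples of pairwise biases form the tetrahedron cut out by the triangle inequalities. -/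
theorem mem_biasTriples_iff {b : ℝ × ℝ × ℝ} :
    b ∈ biasTriples ↔ 0 ≤ 1 + b.1 + b.2.1 + b.2.2 ∧ 0 ≤ 1 + b.1 - b.2.1 - b.2.2 ∧
      0 ≤ 1 - b.1 + b.2.1 - b.2.2 ∧ 0 ≤ 1 - b.1 - b.2.1 + b.2.2 := by
  constructor
  · rintro ⟨p, hp0, hp1, h1, h2, h3⟩
    rw [← h1, ← h2, ← h3, ← hp1]
    simp only [← Finset.sum_add_distrib, ← Finset.sum_sub_distrib]
    have key : ∀ x : Fin 3 → ℤˣ, ((x 0 : ℤ) : ℝ) ∈ ({1, -1} : Set ℝ) ∧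
        ((x 1 : ℤ) : ℝ) ∈ ({1, -1} : Set ℝ) ∧ ((x 2 : ℤ) : ℝ) ∈ ({1, -1} : Set ℝ) := by
      intro x
      refine ⟨?_, ?_, ?_⟩
      · rcases Int.units_eq_one_or (x 0) with h | h <;> simp [h]
      · rcases Int.units_eq_one_or (x 1) with h | h <;> simp [h]
      · rcases Int.units_eq_one_or (x 2) with h | h <;> simp [h]
    refine ⟨?_, ?_, ?_, ?_⟩ <;>
    · refine Finset.sum_nonneg fun x _ => ?_
      have := hp0 x
      obtain ⟨h | h, h' | h', h'' | h''⟩ := key x <;> rw [h, h', h''] <;> linarith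
  · rintro ⟨h1, h2, h3, h4⟩
    refine ⟨fun x => (1 + b.1 * ((x 0 : ℤ) * (x 1 : ℤ)) + b.2.1 * ((x 0 : ℤ) * (x 2 : ℤ))
      + b.2.2 * ((x 1 : ℤ) * (x 2 : ℤ))) / 8, ?_, ?_⟩
    · intro x
      rcases Int.units_eq_one_or (x 0) with h | h <;>
      rcases Int.units_eq_one_or (x 1) with h' | h' <;>
      rcases Int.units_eq_one_or (x 2) with h'' | h'' <;>
      simp only [h, h', h''] <;> push_cast [Units.val_neg, Units.val_one] <;> linarith
    · have e0 : ∑ x : Fin 3 → ℤˣ, (1 : ℝ) = 8 := by simp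
      have e1 : ∑ x : Fin 3 → ℤˣ, (((x 0 : ℤ) : ℝ) * (x 1 : ℤ)) = 0 := by
        exact_mod_cast (by decide : ∑ x : Fin 3 → ℤˣ, ((x 0 : ℤ) * (x 1 : ℤ)) = 0)
      have e2 : ∑ x : Fin 3 → ℤˣ, (((x 0 : ℤ) : ℝ) * (x 2 : ℤ)) = 0 := by
        exact_mod_cast (by decide : ∑ x : Fin 3 → ℤˣ, ((x 0 : ℤ) * (x 2 : ℤ)) = 0)
      have e3 : ∑ x : Fin 3 → ℤˣ, (((x 1 : ℤ) : ℝ) * (x 2 : ℤ)) = 0 := by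
        exact_mod_cast (by decide : ∑ x : Fin 3 → ℤˣ, ((x 1 : ℤ) * (x 2 : ℤ)) = 0)
      have q : ∀ u : ℤˣ, ((u : ℤ) : ℝ) * (u : ℤ) = 1 := by
        intro u
        rcases Int.units_eq_one_or u with h | h <;> simp [h]
      -- A combination of the four characters integrates to its constant coefficient.
      have comb : ∀ k0 k1 k2 k3 : ℝ, ∑ x : Fin 3 → ℤˣ, (k0 * 1 + k1 * ((x 0 : ℤ) * (x 1 : ℤ)) +
          k2 * ((x 0 : ℤ) * (x 2 : ℤ)) + k3 * ((x 1 : ℤ) * (x 2 : ℤ))) / 8 = k0 := by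
        intro k0 k1 k2 k3
        rw [← Finset.sum_div]
        simp only [Finset.sum_add_distrib, ← Finset.mul_sum]
        rw [e0, e1, e2, e3]
        ring
      refine ⟨?_, ?_, ?_, ?_⟩
      · refine Eq.trans (Finset.sum_congr rfl fun x _ => ?_) (comb 1 b.1 b.2.1 b.2.2)
        ring
      · refine Eq.trans (Finset.sum_congr rfl fun x _ => ?_) (comb b.1 1 b.2.2 b.2.1)
        linear_combination (b.1 * ((x 1 : ℤ) * (x 1 : ℤ)) + b.2.1 * ((x 1 : ℤ) * (x 2 : ℤ))) / 8
            * q (x 0) + (b.1 + b.2.2 * ((x 0 : ℤ) * (x 2 : ℤ))) / 8 * q (x 1)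
      · refine Eq.trans (Finset.sum_congr rfl fun x _ => ?_) (comb b.2.1 b.2.2 1 b.1)
        linear_combination (b.2.1 * ((x 2 : ℤ) * (x 2 : ℤ)) + b.1 * ((x 1 : ℤ) * (x 2 : ℤ))) / 8
            * q (x 0) + (b.2.1 + b.2.2 * ((x 0 : ℤ) * (x 1 : ℤ))) / 8 * q (x 2)
      · refine Eq.trans (Finset.sum_congr rfl fun x _ => ?_) (comb b.2.2 b.2.1 b.1 1)
        linear_combination (b.2.2 * ((x 2 : ℤ) * (x 2 : ℤ)) + b.1 * ((x 0 : ℤ) * (x 2 : ℤ))) / 8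
            * q (x 1) + (b.2.2 + b.2.1 * ((x 0 : ℤ) * (x 1 : ℤ))) / 8 * q (x 2)

theorem mem_Icc_of_mem_biasTriples {b : ℝ × ℝ × ℝ} (hb : b ∈ biasTriples) :
    b.1 ∈ Set.Icc (-1 : ℝ) 1 ∧ b.2.1 ∈ Set.Icc (-1 : ℝ) 1 ∧ b.2.2 ∈ Set.Icc (-1 : ℝ) 1 := by
  obtain ⟨h1, h2, h3, h4⟩ := mem_biasTriples_iff.1 hb
  refine ⟨⟨?_, ?_⟩, ⟨?_, ?_⟩, ⟨?_, ?_⟩⟩ <;> linarith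

/-! ### Odd test functions, convex on the unit interval -/

/-- An odd continuous function `h` that is convex on `[0, 1]`. Convexity is recorded by a slope
`s x` of a supporting line at each point `x` of `[0, 1]`, end points included. -/
structure OddConvex (h s : ℝ → ℝ) : Prop where
  continuous : Continuous h
  odd : ∀ x, h (-x) = -h x
  support : ∀ x ∈ Set.Icc (0 : ℝ) 1, ∀ y ∈ Set.Icc (0 : ℝ) 1, h x + s x * (y - x) ≤ h y

/-- The sum of the values of `h` at the three biases. -/
def tripleSum (h : ℝ → ℝ) (b : ℝ × ℝ × ℝ) : ℝ := h b.1 + h b.2.1 + h b.2.2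

/-- The total of the positive parts of the three biases. -/
def posMass (b : ℝ × ℝ × ℝ) : ℝ := max b.1 0 + max b.2.1 0 + max b.2.2 0

/-- The total of the negative parts of the three biases. -/
def negMass (b : ℝ × ℝ × ℝ) : ℝ := max (-b.1) 0 + max (-b.2.1) 0 + max (-b.2.2) 0

variable {h s : ℝ → ℝ}

theorem OddConvex.zero (H : OddConvex h s) : h 0 = 0 := by
  have := H.odd 0
  rw [neg_zero] at this
  linarith

theorem OddConvex.convexOn (H : OddConvex h s) : ConvexOn ℝ (Set.Icc 0 1) h := by
  refine ⟨convex_Icc 0 1, fun x hx y hy a b ha hb hab => ?_⟩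
  have hz := convex_Icc (0 : ℝ) 1 hx hy ha hb hab
  simp only [smul_eq_mul] at hz ⊢
  set z := a * x + b * y with hz'
  have e1 := mul_le_mul_of_nonneg_left (H.support z hz x hx) ha
  have e2 := mul_le_mul_of_nonneg_left (H.support z hz y hy) hb
  have : a * (h z + s z * (x - z)) + b * (h z + s z * (y - z)) = h z := by
    have hb' : b = 1 - a := by linarith
    rw [hz', hb']; ring
  linarith

/-- A convex function that vanishes at `0` is star-shaped. -/
theorem OddConvex.map_mul_le (H : OddConvex h s) {t x : ℝ} (ht : t ∈ Set.Icc (0 : ℝ) 1)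
    (hx : x ∈ Set.Icc (0 : ℝ) 1) : h (t * x) ≤ t * h x := by
  have := H.convexOn.2 hx (y := 0) ⟨le_rfl, zero_le_one⟩ ht.1 (sub_nonneg.2 ht.2) (by ring)
  simpa [H.zero] using this

theorem OddConvex.midpoint (H : OddConvex h s) {x y : ℝ} (hx : x ∈ Set.Icc (0 : ℝ) 1)
    (hy : y ∈ Set.Icc (0 : ℝ) 1) : 2 * h ((x + y) / 2) ≤ h x + h y := by
  have := H.convexOn.2 hx hy (show (0 : ℝ) ≤ 1 / 2 by norm_num) (show (0 : ℝ) ≤ 1 / 2 by norm_num)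
    (by norm_num)
  simp only [smul_eq_mul] at this
  rw [show (1 / 2 : ℝ) * x + 1 / 2 * y = (x + y) / 2 by ring] at this
  linarith

theorem OddConvex.slope_mono (H : OddConvex h s) {x y : ℝ} (hx : x ∈ Set.Icc (0 : ℝ) 1)
    (hy : y ∈ Set.Icc (0 : ℝ) 1) (hxy : x < y) : s x ≤ s y := by
  have e1 := H.support x hx y hy
  have e2 := H.support y hy x hx
  by_contra! hc
  nlinarith

/-- To the left of `x`, a convex function lies above each line through `(x, h x)` whose slope
is that of a supporting line further to the right. -/
theorem OddConvex.support_left (H : OddConvex h s) {x y z : ℝ} (hx : x ∈ Set.Icc (0 : ℝ) 1)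
    (hy : y ∈ Set.Icc (0 : ℝ) 1) (hz : z ∈ Set.Icc (0 : ℝ) 1) (hzx : z ≤ x) (hxy : x ≤ y) :
    h x + s y * (z - x) ≤ h z := by
  have e1 := H.support x hx z hz
  rcases hxy.eq_or_lt with rfl | hlt
  · exact e1
  · have := H.slope_mono hx hy hlt
    nlinarith

/-! ### Pointwise bounds on `tripleSum` -/

theorem posMass_sub_negMass (b : ℝ × ℝ × ℝ) : posMass b - negMass b = b.1 + b.2.1 + b.2.2 := by
  have key : ∀ x : ℝ, max x 0 - max (-x) 0 = x := fun x => by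
    rcases le_total x 0 with h | h <;> simp [h]
  unfold posMass negMass
  linarith [key b.1, key b.2.1, key b.2.2]

theorem posMass_nonneg (b : ℝ × ℝ × ℝ) : 0 ≤ posMass b := by unfold posMass; positivity

theorem negMass_nonneg (b : ℝ × ℝ × ℝ) : 0 ≤ negMass b := by unfold negMass; positivity

theorem negMass_le_three_sub_posMass {b : ℝ × ℝ × ℝ} (hb : b ∈ biasTriples) :
    negMass b ≤ 3 - posMass b := by
  obtain ⟨h1, h2, h3⟩ := mem_Icc_of_mem_biasTriples hb
  have key : ∀ x ∈ Set.Icc (-1 : ℝ) 1, max (-x) 0 + max x 0 ≤ 1 := fun x hx => by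
    rcases le_total x 0 with h | h <;> simp [h] <;> linarith [hx.1, hx.2]
  unfold posMass negMass
  linarith [key _ h1, key _ h2, key _ h3]

theorem negMass_le_one_add_posMass {b : ℝ × ℝ × ℝ} (hb : b ∈ biasTriples) :
    negMass b ≤ 1 + posMass b := by
  have := (mem_biasTriples_iff.1 hb).1
  linarith [posMass_sub_negMass b]

/-- A bias triple of large negative mass has exactly one positive entry. -/
theorem exists_signs {b : ℝ × ℝ × ℝ} (hb : b ∈ biasTriples) (hP : posMass b ≤ 1)
    (hN : 3 < 3 * negMass b + posMass b) :
    ∃ x y : ℝ, 0 ≤ x ∧ x ≤ 1 ∧ 0 ≤ y ∧ y ≤ 1 ∧ negMass b = x + y ∧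
      ∀ h s : ℝ → ℝ, OddConvex h s → tripleSum h b = h (posMass b) - h x - h y := by
  obtain ⟨h1, h2, h3, h4⟩ := mem_biasTriples_iff.1 hb
  obtain ⟨⟨l1, u1⟩, ⟨l2, u2⟩, ⟨l3, u3⟩⟩ := mem_Icc_of_mem_biasTriples hb
  obtain ⟨b1, b2, b3⟩ := b
  simp only [posMass, negMass, tripleSum] at *
  rcases le_total b1 0 with g1 | g1 <;> rcases le_total b2 0 with g2 | g2 <;>
  rcases le_total b3 0 with g3 | g3 <;>
  simp only [g1, g2, g3, max_eq_left, max_eq_right, neg_nonneg, neg_nonpos, zero_add, add_zero]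
    at hP hN ⊢
  · linarith
  · exact ⟨-b1, -b2, by linarith, by linarith, by linarith, by linarith, rfl,
      fun h s H => by rw [H.odd, H.odd]; ring⟩
  · exact ⟨-b1, -b3, by linarith, by linarith, by linarith, by linarith, rfl,
      fun h s H => by rw [H.odd, H.odd]; ring⟩
  · linarith
  · exact ⟨-b2, -b3, by linarith, by linarith, by linarith, by linarith, rfl,
      fun h s H => by rw [H.odd, H.odd]; ring⟩
  · linarith
  · linarith
  · linarith

theorem posMass_le_one {b : ℝ × ℝ × ℝ} (hb : b ∈ biasTriples) (hN : 0 < negMass b) :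
    posMass b ≤ 1 := by
  obtain ⟨h1, h2, h3, h4⟩ := mem_biasTriples_iff.1 hb
  obtain ⟨⟨l1, u1⟩, ⟨l2, u2⟩, ⟨l3, u3⟩⟩ := mem_Icc_of_mem_biasTriples hb
  obtain ⟨b1, b2, b3⟩ := b
  simp only [posMass, negMass] at *
  rcases le_total b1 0 with g1 | g1 <;> rcases le_total b2 0 with g2 | g2 <;>
  rcases le_total b3 0 with g3 | g3 <;>
  simp only [g1, g2, g3, max_eq_left, max_eq_right, neg_nonneg, neg_nonpos, zero_add, add_zero]
    at hN ⊢ <;> linarith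

/-- Positive biases are spread to `0` and `1`; a line below `h` on `[0, 1]` bounds the rest. -/
theorem OddConvex.tripleSum_le_line (H : OddConvex h s) {b : ℝ × ℝ × ℝ} (hb : b ∈ biasTriples)
    {l m : ℝ} (hl : ∀ x ∈ Set.Icc (0 : ℝ) 1, l + m * x ≤ h x) :
    tripleSum h b ≤ posMass b * h 1 - (3 - posMass b) * l - m * negMass b := by
  have key : ∀ x ∈ Set.Icc (-1 : ℝ) 1,
      h x ≤ max x 0 * h 1 - (1 - max x 0) * l - m * max (-x) 0 := by
    intro x hx
    rcases le_total x 0 with g | g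
    · have := hl (-x) ⟨by linarith, by linarith [hx.1]⟩
      rw [H.odd] at this
      simp [g]
      linarith
    · have e1 := H.map_mul_le (t := x) (x := 1) ⟨g, hx.2⟩ ⟨zero_le_one, le_rfl⟩
      have e2 := hl 0 ⟨le_rfl, zero_le_one⟩
      rw [H.zero] at e2
      rw [mul_one] at e1
      simp only [g, max_eq_left, neg_nonpos, max_eq_right]
      nlinarith [hx.2]
  obtain ⟨h1, h2, h3⟩ := mem_Icc_of_mem_biasTriples hb
  unfold tripleSum posMass negMass
  linarith [key _ h1, key _ h2, key _ h3]

theorem OddConvex.tripleSum_le_of_large_negMass (H : OddConvex h s) {b : ℝ × ℝ × ℝ}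
    (hb : b ∈ biasTriples) (hP : posMass b ≤ 1) (hN : 3 < 3 * negMass b + posMass b) :
    tripleSum h b ≤ h (posMass b) - 2 * h (negMass b / 2) := by
  obtain ⟨x, y, hx0, hx1, hy0, hy1, e, hh⟩ := exists_signs hb hP hN
  rw [hh h s H, e]
  linarith [H.midpoint ⟨hx0, hx1⟩ ⟨hy0, hy1⟩]

/-- The weight of `(-1/3, -1/3, -1/3)` in the mixture with `(-r, -r, 1)`, `r = negMass b / 2`,
that replaces a triple with `negMass b > 1`; it makes the two means of the sum of the biases
agree. At `b = (-1, -1, 1)` the quotient is `0 / 0 = 0`, as wanted. -/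
def thirdWeight (b : ℝ × ℝ × ℝ) : ℝ :=
  if negMass b ≤ 1 then 0 else (1 - posMass b) / (2 - negMass b)

/-- The positive mass after the replacement of the triples with `negMass b > 1`. -/
def adjPos (b : ℝ × ℝ × ℝ) : ℝ := if negMass b ≤ 1 then posMass b else 1 - thirdWeight b

/-- The negative mass after the replacement of the triples with `negMass b > 1`. -/
def adjNeg (b : ℝ × ℝ × ℝ) : ℝ := thirdWeight b + (1 - thirdWeight b) * negMass b

theorem negMass_le_two {b : ℝ × ℝ × ℝ} (hb : b ∈ biasTriples) : negMass b ≤ 2 := by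
  linarith [negMass_le_three_sub_posMass hb, negMass_le_one_add_posMass hb]

theorem thirdWeight_mul {b : ℝ × ℝ × ℝ} (hb : b ∈ biasTriples) (hN : 1 < negMass b) :
    thirdWeight b * (2 - negMass b) = 1 - posMass b := by
  rw [thirdWeight, if_neg hN.not_ge]
  have h2 := negMass_le_two hb
  rcases h2.eq_or_lt with h | h
  · have := posMass_le_one hb (by linarith)
    have := negMass_le_one_add_posMass hb
    rw [h, show posMass b = 1 by linarith]; simp
  · field_simp [(sub_pos.2 h).ne']

theorem thirdWeight_mem {b : ℝ × ℝ × ℝ} (hb : b ∈ biasTriples) :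
    thirdWeight b ∈ Set.Icc (0 : ℝ) 1 := by
  rw [thirdWeight]
  split_ifs with hN
  · simp
  · push Not at hN
    have h1 := posMass_le_one hb (by linarith)
    have h2 := negMass_le_two hb
    have h3 := negMass_le_one_add_posMass hb
    exact ⟨div_nonneg (by linarith) (by linarith), div_le_one_of_le₀ (by linarith) (by linarith)⟩

theorem adjPos_sub_adjNeg {b : ℝ × ℝ × ℝ} (hb : b ∈ biasTriples) :
    adjPos b - adjNeg b = b.1 + b.2.1 + b.2.2 := by
  rw [← posMass_sub_negMass, adjPos, adjNeg]
  split_ifs with hN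
  · simp [thirdWeight, hN]
  · linarith [thirdWeight_mul hb (not_le.1 hN)]

theorem adjPos_nonneg {b : ℝ × ℝ × ℝ} (hb : b ∈ biasTriples) : 0 ≤ adjPos b := by
  rw [adjPos]
  split_ifs
  · exact posMass_nonneg b
  · linarith [(thirdWeight_mem hb).2]

theorem adjNeg_nonneg {b : ℝ × ℝ × ℝ} (hb : b ∈ biasTriples) : 0 ≤ adjNeg b := by
  obtain ⟨h0, h1⟩ := thirdWeight_mem hb
  have := mul_nonneg (sub_nonneg.2 h1) (negMass_nonneg b)
  rw [adjNeg]
  linarith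

theorem adjNeg_le_three_sub {b : ℝ × ℝ × ℝ} (hb : b ∈ biasTriples) : adjNeg b ≤ 3 - adjPos b := by
  obtain ⟨h0, h1⟩ := thirdWeight_mem hb
  rw [adjPos, adjNeg]
  split_ifs with hN
  · simpa [thirdWeight, hN] using negMass_le_three_sub_posMass hb
  · nlinarith [negMass_le_two hb]

theorem adjNeg_le_one_add {b : ℝ × ℝ × ℝ} (hb : b ∈ biasTriples) : adjNeg b ≤ 1 + adjPos b := by
  have := (mem_biasTriples_iff.1 hb).1
  linarith [adjPos_sub_adjNeg hb]

/-- The replacement of a triple with `negMass b > 1` does not decrease `tripleSum h`. -/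
theorem OddConvex.tripleSum_le_of_one_lt (H : OddConvex h s) {b : ℝ × ℝ × ℝ}
    (hb : b ∈ biasTriples) (hN : 1 < negMass b) :
    tripleSum h b ≤ (1 - thirdWeight b) * h 1 - 3 * thirdWeight b * h (1 / 3)
      - 2 * (1 - thirdWeight b) * h (negMass b / 2) := by
  have hP0 := posMass_nonneg b
  have hP := posMass_le_one hb (by linarith)
  have hT := H.tripleSum_le_of_large_negMass hb hP (by linarith)
  have hN2 := negMass_le_two hb
  obtain ⟨h0, h1⟩ := thirdWeight_mem hb
  have ew := thirdWeight_mul hb hN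
  set a := thirdWeight b
  set r := negMass b / 2 with hr
  have hr' : negMass b = 2 * r := by rw [hr]; ring
  have hr1 : r ≤ 1 := by linarith
  have hr0 : 1 / 2 < r := by linarith
  have i1 : (1 : ℝ) ∈ Set.Icc (0 : ℝ) 1 := ⟨zero_le_one, le_rfl⟩
  have ir : r ∈ Set.Icc (0 : ℝ) 1 := ⟨by linarith, hr1⟩
  have ir' : 2 * r - 1 ∈ Set.Icc (0 : ℝ) 1 := ⟨by linarith, by linarith⟩
  have c1 := H.convexOn.2 i1 ir' (sub_nonneg.2 h1) h0 (by ring)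
  simp only [smul_eq_mul] at c1
  rw [show (1 - a) * 1 + a * (2 * r - 1) = posMass b by rw [hr'] at ew; linarith] at c1
  have c2 := H.map_mul_le (t := (2 * r - 1) / r)
    ⟨div_nonneg (by linarith) (by linarith), div_le_one_of_le₀ (by linarith) (by linarith)⟩ ir
  have c3 := H.map_mul_le (t := (1 / 3) / r)
    ⟨div_nonneg (by linarith) (by linarith), div_le_one_of_le₀ (by linarith) (by linarith)⟩ ir
  rw [div_mul_cancel₀ _ (by linarith : r ≠ 0)] at c2 c3
  have c4 : (2 * r - 1) / r * h r + 3 * ((1 / 3) / r * h r) = 2 * h r := by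
    field_simp [(by linarith : r ≠ 0)]; ring
  nlinarith

/-- The bound that leads to the first and the third hard form. -/
theorem OddConvex.tripleSum_le_support (H : OddConvex h s) {b : ℝ × ℝ × ℝ}
    (hb : b ∈ biasTriples) {ρ : ℝ} (hρ : ρ ∈ Set.Icc (0 : ℝ) 1) :
    tripleSum h b ≤
      adjPos b * h 1 - (3 - adjPos b) * (h ρ - s ρ * ρ) - s ρ * adjNeg b := by
  by_cases hN : negMass b ≤ 1
  · simp only [adjPos, adjNeg, thirdWeight, hN, if_true, zero_add, sub_zero, one_mul]
    refine H.tripleSum_le_line hb fun x hx => ?_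
    linarith [H.support ρ hρ x hx]
  · have hN' := not_le.1 hN
    have e1 := H.tripleSum_le_of_one_lt hb hN'
    obtain ⟨h0, h1⟩ := thirdWeight_mem hb
    have e2 := H.support ρ hρ (1 / 3) ⟨by norm_num, by norm_num⟩
    have e3 := H.support ρ hρ (negMass b / 2) ⟨by linarith, by linarith [negMass_le_two hb]⟩
    simp only [adjPos, adjNeg, hN, if_false]
    set a := thirdWeight b
    have e4 := mul_le_mul_of_nonneg_left e2 h0
    have e5 := mul_le_mul_of_nonneg_left e3 (sub_nonneg.2 h1)
    linarith

/-- The bound that leads to the second hard form. -/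
theorem OddConvex.tripleSum_le_third (H : OddConvex h s) {b : ℝ × ℝ × ℝ}
    (hb : b ∈ biasTriples) {ρ : ℝ} (hρ : ρ ∈ Set.Icc (1 / 3 : ℝ) 1) :
    tripleSum h b ≤ adjPos b * h 1 - 3 * (1 - adjPos b) * h (1 / 3)
      - 2 * adjPos b * (h ρ - s ρ * ρ) - s ρ * (adjNeg b - 1 + adjPos b) := by
  have hρ' : ρ ∈ Set.Icc (0 : ℝ) 1 := ⟨by linarith [hρ.1], hρ.2⟩
  have i3 : (1 / 3 : ℝ) ∈ Set.Icc (0 : ℝ) 1 := ⟨by norm_num, by norm_num⟩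
  have s0 := H.support ρ hρ' 0 ⟨le_rfl, zero_le_one⟩
  have s3 := H.support ρ hρ' (1 / 3) i3
  rw [H.zero] at s0
  have hP0 := posMass_nonneg b
  have hN0 := negMass_nonneg b
  by_cases hN : negMass b ≤ 1
  · simp only [adjPos, adjNeg, thirdWeight, hN, if_true, zero_add, sub_zero, one_mul]
    by_cases hP : posMass b ≤ 1
    · by_cases hNP : 3 * negMass b + posMass b ≤ 3
      · -- All negative mass is moved to its mean `x ≤ 1/3`.
        set x := negMass b / (3 - posMass b) with hx
        have hx' : (3 - posMass b) * x = negMass b := by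
          rw [hx]; field_simp [(by linarith : 3 - posMass b ≠ 0)]
        have hx0 : 0 ≤ x := div_nonneg hN0 (by linarith)
        have hx3 : x ≤ 1 / 3 := by rw [hx, div_le_iff₀ (by linarith)]; linarith
        have ix : x ∈ Set.Icc (0 : ℝ) 1 := ⟨hx0, by linarith⟩
        have e := H.tripleSum_le_line hb (l := h x - s x * x) (m := s x)
          fun y hy => by linarith [H.support x ix y hy]
        have e' : tripleSum h b ≤ posMass b * h 1 - (3 - posMass b) * h x := by
          rw [← hx'] at e
          linarith
        have l1 := mul_le_mul_of_nonneg_left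
          (H.support_left i3 hρ' ix hx3 hρ.1) (sub_nonneg.2 hP)
        have l2 := mul_le_mul_of_nonneg_left (H.support ρ hρ' x ix) hP0
        rw [← hx']
        linarith
      · -- There is exactly one positive bias, and the mean negative mass exceeds `1/3`.
        push Not at hNP
        have e := H.tripleSum_le_of_large_negMass hb hP hNP
        have e1 := H.map_mul_le (t := posMass b) (x := 1) ⟨hP0, hP⟩ ⟨zero_le_one, le_rfl⟩
        rw [mul_one] at e1
        set r := negMass b / 2 with hr
        have hr' : negMass b = 2 * r := by rw [hr]; ring
        rw [hr'] at hN hNP ⊢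
        have hr3 : 1 / 3 ≤ r := by linarith
        have ir : r ∈ Set.Icc (0 : ℝ) 1 := ⟨by linarith, by linarith⟩
        have e2 := H.support ρ hρ' r ir
        have e3 := H.map_mul_le (t := (1 / 3) / r)
          ⟨div_nonneg (by linarith) (by linarith), div_le_one_of_le₀ (by linarith) (by linarith)⟩ ir
        rw [div_mul_cancel₀ _ (by linarith : r ≠ 0)] at e3
        have e4 : r * h (1 / 3) ≤ 1 / 3 * h r := by
          have := mul_le_mul_of_nonneg_left e3 ir.1
          rwa [← mul_assoc, mul_div_cancel₀ _ (by linarith : r ≠ 0)] at this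
        set p := posMass b
        -- The claim is affine in `p`: it is checked at `p = 3 - 6 r` and at `p = 1`.
        have end0 : 3 * (1 - (3 - 6 * r)) * h (1 / 3) + 2 * (3 - 6 * r) * (h ρ - s ρ * ρ)
            + s ρ * (2 * r - 1 + (3 - 6 * r)) ≤ 2 * h r := by
          nlinarith
        have end1 : 2 * (h ρ - s ρ * ρ) + s ρ * (2 * r) ≤ 2 * h r := by linarith
        have key : (6 * r - 2) * (3 * (1 - p) * h (1 / 3) + 2 * p * (h ρ - s ρ * ρ)
            + s ρ * (2 * r - 1 + p)) ≤ (6 * r - 2) * (2 * h r) := by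
          have f0 := mul_le_mul_of_nonneg_left end0 (sub_nonneg.2 hP)
          have f1 := mul_le_mul_of_nonneg_left end1 (show 0 ≤ p - (3 - 6 * r) by linarith)
          linarith
        have key' := le_of_mul_le_mul_left key (by linarith)
        linarith
    · -- All biases are nonnegative.
      push Not at hP
      have hN00 : negMass b = 0 := by
        by_contra hne
        exact absurd (posMass_le_one hb (lt_of_le_of_ne hN0 (Ne.symm hne))) (not_le.2 hP)
      have e := H.tripleSum_le_line hb (l := 0) (m := s 0) fun y hy => by
        have := H.support 0 ⟨le_rfl, zero_le_one⟩ y hy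
        rw [H.zero] at this
        linarith
      have hP3 := negMass_le_three_sub_posMass hb
      rw [hN00] at e hP3 ⊢
      nlinarith
  · have hN' := not_le.1 hN
    have e1 := H.tripleSum_le_of_one_lt hb hN'
    obtain ⟨h0, h1⟩ := thirdWeight_mem hb
    have e3 := H.support ρ hρ' (negMass b / 2) ⟨by linarith, by linarith [negMass_le_two hb]⟩
    simp only [adjPos, adjNeg, hN, if_false]
    set a := thirdWeight b
    have e5 := mul_le_mul_of_nonneg_left e3 (sub_nonneg.2 h1)
    linarith

end

section

variable {h s : ℝ → ℝ}

/-! ### Two-point distributions of hard form -/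

/-- The distribution with mass `1 - w` at `P` and mass `w` at `Q`. -/
def twoPoint (w : ℝ) (P Q : ℝ × ℝ × ℝ) : Measure (ℝ × ℝ × ℝ) :=
  ENNReal.ofReal (1 - w) • Measure.dirac P + ENNReal.ofReal w • Measure.dirac Q

/-- The pairs of points on which the distributions of hard form are supported. -/
def hardPairs : Set ((ℝ × ℝ × ℝ) × (ℝ × ℝ × ℝ)) :=
  (fun ρ : ℝ => ((-ρ, -ρ, -ρ), (-ρ, -ρ, 1))) '' Set.Icc (0 : ℝ) (1 / 3) ∪
  (fun ρ : ℝ => ((-1 / 3, -1 / 3, -1 / 3), (-ρ, -ρ, 1))) '' Set.Icc (1 / 3 : ℝ) 1 ∪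
  (fun ρ : ℝ => ((-ρ, -ρ, 1), (1, 1, 1))) '' Set.Icc (-1 : ℝ) 1

theorem isCompact_hardPairs : IsCompact hardPairs := by
  refine ((isCompact_Icc.image ?_).union (isCompact_Icc.image ?_)).union
    (isCompact_Icc.image ?_) <;> fun_prop

theorem mem_biasTriples_of_mem_hardPairs {p : (ℝ × ℝ × ℝ) × (ℝ × ℝ × ℝ)} (hp : p ∈ hardPairs) :
    p.1 ∈ biasTriples ∧ p.2 ∈ biasTriples := by
  simp only [mem_biasTriples_iff]
  rcases hp with (⟨ρ, ⟨h0, h1⟩, rfl⟩ | ⟨ρ, ⟨h0, h1⟩, rfl⟩) | ⟨ρ, ⟨h0, h1⟩, rfl⟩ <;> dsimp only <;>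
    refine ⟨⟨?_, ?_, ?_, ?_⟩, ?_, ?_, ?_, ?_⟩ <;> linarith

theorem supportedOn_twoPoint (w : ℝ) {P Q : ℝ × ℝ × ℝ} {S : Set (ℝ × ℝ × ℝ)} (hP : P ∈ S)
    (hQ : Q ∈ S) : ∀ᵐ b ∂(twoPoint w P Q), b ∈ S := by
  rw [twoPoint, ae_add_measure_iff]
  exact ⟨Measure.ae_smul_measure (by simpa [ae_dirac_eq] using hP) _,
    Measure.ae_smul_measure (by simpa [ae_dirac_eq] using hQ) _⟩

theorem isHardForm_twoPoint (w : ℝ) {p : (ℝ × ℝ × ℝ) × (ℝ × ℝ × ℝ)} (hp : p ∈ hardPairs) :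
    IsHardForm (twoPoint w p.1 p.2) := by
  rcases hp with (⟨ρ, hρ, rfl⟩ | ⟨ρ, hρ, rfl⟩) | ⟨ρ, hρ, rfl⟩
  · exact Or.inl ⟨ρ, hρ, supportedOn_twoPoint w (by simp) (by simp)⟩
  · exact Or.inr (Or.inl ⟨ρ, hρ, supportedOn_twoPoint w (by simp) (by simp)⟩)
  · exact Or.inr (Or.inr ⟨ρ, hρ, supportedOn_twoPoint w (by simp) (by simp)⟩)

theorem isProbabilityMeasure_twoPoint {w : ℝ} (hw : w ∈ Set.Icc (0 : ℝ) 1) (P Q : ℝ × ℝ × ℝ) :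
    IsProbabilityMeasure (twoPoint w P Q) := by
  refine ⟨?_⟩
  simp only [twoPoint, Measure.coe_add, Measure.coe_smul, Pi.add_apply, Pi.smul_apply,
    measure_univ, smul_eq_mul, mul_one]
  rw [← ENNReal.ofReal_add (sub_nonneg.2 hw.2) hw.1]
  simp

theorem integral_twoPoint {w : ℝ} (hw : w ∈ Set.Icc (0 : ℝ) 1) (P Q : ℝ × ℝ × ℝ)
    (g : ℝ × ℝ × ℝ → ℝ) : ∫ b, g b ∂(twoPoint w P Q) = (1 - w) * g P + w * g Q := by
  have hi : ∀ (t : ℝ) (R : ℝ × ℝ × ℝ), Integrable g (ENNReal.ofReal t • Measure.dirac R) :=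
    fun t R => (integrable_dirac (by simp)).smul_measure ENNReal.ofReal_ne_top
  rw [twoPoint, integral_add_measure (hi _ _) (hi _ _), integral_smul_measure,
    integral_smul_measure, integral_dirac, integral_dirac, ENNReal.toReal_ofReal hw.1,
    ENNReal.toReal_ofReal (sub_nonneg.2 hw.2), smul_eq_mul, smul_eq_mul]

theorem isBiasDistribution_twoPoint {w : ℝ} (hw : w ∈ Set.Icc (0 : ℝ) 1) {P Q : ℝ × ℝ × ℝ}
    (hP : P ∈ biasTriples) (hQ : Q ∈ biasTriples) : IsBiasDistribution (twoPoint w P Q) :=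
  ⟨isProbabilityMeasure_twoPoint hw P Q, supportedOn_twoPoint w hP hQ⟩

/-! ### Domination by a distribution of hard form -/

theorem measurable_posMass : Measurable posMass := by unfold posMass; fun_prop

theorem measurable_negMass : Measurable negMass := by unfold negMass; fun_prop

theorem measurable_thirdWeight : Measurable thirdWeight :=
  Measurable.ite (measurable_negMass measurableSet_Iic) measurable_const
    ((measurable_const.sub measurable_posMass).div (measurable_const.sub measurable_negMass))

theorem measurable_adjPos : Measurable adjPos :=
  Measurable.ite (measurable_negMass measurableSet_Iic) measurable_posMass
    (measurable_const.sub measurable_thirdWeight)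

theorem measurable_adjNeg : Measurable adjNeg :=
  measurable_thirdWeight.add ((measurable_const.sub measurable_thirdWeight).mul measurable_negMass)

theorem integrable_of_abs_le {D : Measure (ℝ × ℝ × ℝ)} (hD : IsBiasDistribution D)
    {g : ℝ × ℝ × ℝ → ℝ} (hg : Measurable g) (C : ℝ) (hC : ∀ b ∈ biasTriples, |g b| ≤ C) :
    Integrable g D := by
  have := hD.1
  exact Integrable.of_bound hg.aestronglyMeasurable C (hD.2.mono fun b hb => hC b hb)

theorem integrable_adjPos {D : Measure (ℝ × ℝ × ℝ)} (hD : IsBiasDistribution D) :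
    Integrable adjPos D :=
  integrable_of_abs_le hD measurable_adjPos 3 fun b hb =>
    abs_le.2 ⟨by linarith [adjPos_nonneg hb],
      by linarith [adjNeg_nonneg hb, adjNeg_le_three_sub hb]⟩

theorem integrable_adjNeg {D : Measure (ℝ × ℝ × ℝ)} (hD : IsBiasDistribution D) :
    Integrable adjNeg D :=
  integrable_of_abs_le hD measurable_adjNeg 3 fun b hb =>
    abs_le.2 ⟨by linarith [adjNeg_nonneg hb],
      by linarith [adjPos_nonneg hb, adjNeg_le_three_sub hb]⟩

theorem abs_tripleSum_le {b : ℝ × ℝ × ℝ} (hb : b ∈ biasTriples) {C : ℝ}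
    (hC : ∀ x ∈ Set.Icc (-1 : ℝ) 1, |h x| ≤ C) : |tripleSum h b| ≤ 3 * C := by
  obtain ⟨h1, h2, h3⟩ := mem_Icc_of_mem_biasTriples hb
  unfold tripleSum
  linarith [abs_add_three (h b.1) (h b.2.1) (h b.2.2), hC _ h1, hC _ h2, hC _ h3]

theorem measurable_tripleSum (hh : Continuous h) : Measurable (tripleSum h) := by
  unfold tripleSum
  exact Continuous.measurable (by fun_prop)

theorem integrable_tripleSum {D : Measure (ℝ × ℝ × ℝ)} (hD : IsBiasDistribution D)
    (hh : Continuous h) : Integrable (tripleSum h) D := by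
  obtain ⟨C, hC⟩ := isCompact_Icc.exists_bound_of_continuousOn (s := Set.Icc (-1 : ℝ) 1)
    hh.continuousOn
  exact integrable_of_abs_le hD (measurable_tripleSum hh) (3 * C)
    fun b hb => abs_tripleSum_le hb hC

theorem integral_sdpValue {D : Measure (ℝ × ℝ × ℝ)} (hD : IsBiasDistribution D) :
    ∫ b, sdpValue b ∂D = (3 - ∫ b, tripleSum id b ∂D) / 4 := by
  have := hD.1
  have e : ∀ b, sdpValue b = (3 - tripleSum id b) / 4 := fun b => by
    simp only [sdpValue, tripleSum, id]; ring
  simp only [e]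
  rw [integral_div, integral_sub (integrable_const _) (integrable_tripleSum hD continuous_id)]
  simp

theorem hasCompleteness_twoPoint_iff {w c : ℝ} (hw : w ∈ Set.Icc (0 : ℝ) 1)
    {p : (ℝ × ℝ × ℝ) × (ℝ × ℝ × ℝ)} (hp : p ∈ hardPairs) :
    HasCompleteness (twoPoint w p.1 p.2) c ↔
      (1 - w) * tripleSum id p.1 + w * tripleSum id p.2 = 3 - 4 * c := by
  obtain ⟨h1, h2⟩ := mem_biasTriples_of_mem_hardPairs hp
  have hb := isBiasDistribution_twoPoint hw h1 h2
  rw [HasCompleteness, integral_sdpValue hb, integral_twoPoint hw]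
  exact ⟨fun h => by linarith [h.2], fun h => ⟨hb, by linarith⟩⟩

/-- A pointwise affine bound of `tripleSum h` in terms of the adjusted masses integrates to
the same bound for their means. -/
theorem integral_tripleSum_le {D : Measure (ℝ × ℝ × ℝ)} (hD : IsBiasDistribution D)
    (hh : Continuous h) {k₀ k₁ k₂ : ℝ}
    (hle : ∀ b ∈ biasTriples, tripleSum h b ≤ k₀ + k₁ * adjPos b + k₂ * adjNeg b) :
    ∫ b, tripleSum h b ∂D ≤ k₀ + k₁ * ∫ b, adjPos b ∂D + k₂ * ∫ b, adjNeg b ∂D := by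
  have := hD.1
  have ip := integrable_adjPos hD
  have iN := integrable_adjNeg hD
  have ik : Integrable (fun b => k₀ + k₁ * adjPos b) D :=
    (integrable_const _).add (ip.const_mul _)
  calc ∫ b, tripleSum h b ∂D ≤ ∫ b, (k₀ + k₁ * adjPos b + k₂ * adjNeg b) ∂D :=
        integral_mono_ae (integrable_tripleSum hD hh) (ik.add (iN.const_mul _))
          (hD.2.mono fun b hb => hle b hb)
    _ = _ := by
        rw [integral_add ik (iN.const_mul _), integral_add (integrable_const _) (ip.const_mul _),
          integral_const_mul, integral_const_mul]
        simp

/-- Every distribution of bias triples is dominated, for all odd test functions convex on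
`[0, 1]` at once, by a two-point distribution of hard form with the same completeness. -/
theorem exists_dominating {D : Measure (ℝ × ℝ × ℝ)} {c : ℝ} (hD : HasCompleteness D c) :
    ∃ w ∈ Set.Icc (0 : ℝ) 1, ∃ p ∈ hardPairs, HasCompleteness (twoPoint w p.1 p.2) c ∧
      ∀ h s, OddConvex h s →
        ∫ b, tripleSum h b ∂D ≤ (1 - w) * tripleSum h p.1 + w * tripleSum h p.2 := by
  obtain ⟨hB, hc⟩ := hD
  have hprob := hB.1
  have ip := integrable_adjPos hB
  have iN := integrable_adjNeg hB
  have hmass : ∫ b, adjPos b ∂D - ∫ b, adjNeg b ∂D = ∫ b, tripleSum id b ∂D := by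
    rw [← integral_sub ip iN]
    exact integral_congr_ae (hB.2.mono fun b hb => adjPos_sub_adjNeg hb)
  have hp0 : 0 ≤ ∫ b, adjPos b ∂D := integral_nonneg_of_ae (hB.2.mono fun b hb => adjPos_nonneg hb)
  have hn0 : 0 ≤ ∫ b, adjNeg b ∂D := integral_nonneg_of_ae (hB.2.mono fun b hb => adjNeg_nonneg hb)
  have hn3 : ∫ b, adjNeg b ∂D ≤ 3 - ∫ b, adjPos b ∂D := by
    have := integral_mono_ae iN ((integrable_const (3 : ℝ)).sub ip)
      (hB.2.mono fun b hb => adjNeg_le_three_sub hb)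
    simp only [Pi.sub_apply] at this
    rw [integral_sub (integrable_const _) ip] at this
    simpa using this
  have hn1 : ∫ b, adjNeg b ∂D ≤ 1 + ∫ b, adjPos b ∂D := by
    have := integral_mono_ae iN ((integrable_const (1 : ℝ)).add ip)
      (hB.2.mono fun b hb => adjNeg_le_one_add hb)
    simp only [Pi.add_apply] at this
    rw [integral_add (integrable_const _) ip] at this
    simpa using this
  have hint : ∀ h s, OddConvex h s → ∀ k₀ k₁ k₂ : ℝ,
      (∀ b ∈ biasTriples, tripleSum h b ≤ k₀ + k₁ * adjPos b + k₂ * adjNeg b) →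
      ∫ b, tripleSum h b ∂D ≤ k₀ + k₁ * ∫ b, adjPos b ∂D + k₂ * ∫ b, adjNeg b ∂D :=
    fun h s H k₀ k₁ k₂ hle => integral_tripleSum_le hB H.continuous hle
  rw [integral_sdpValue hB, ← hmass] at hc
  set p := ∫ b, adjPos b ∂D
  set n := ∫ b, adjNeg b ∂D
  have compl : ∀ w ∈ Set.Icc (0 : ℝ) 1, ∀ q ∈ hardPairs,
      (1 - w) * tripleSum id q.1 + w * tripleSum id q.2 = p - n →
      HasCompleteness (twoPoint w q.1 q.2) c := fun w hw q hq he =>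
    (hasCompleteness_twoPoint_iff hw hq).2 (by linarith)
  by_cases hp1 : 1 ≤ p
  · -- Third form: the negative mass is spread evenly over the first two entries.
    have hρ' : (3 - p) * (n / (3 - p)) = n := by
      rcases (sub_nonneg.1 (hn0.trans hn3)).eq_or_lt with h | h
      · rw [h] at hn3 ⊢; simp; linarith
      · field_simp [(sub_pos.2 h).ne']
    have hρ : n / (3 - p) ∈ Set.Icc (0 : ℝ) 1 :=
      ⟨div_nonneg hn0 (hn0.trans hn3), div_le_one_of_le₀ hn3 (hn0.trans hn3)⟩
    set ρ := n / (3 - p)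
    refine ⟨(p - 1) / 2, ⟨by linarith, by linarith⟩, ((-ρ, -ρ, 1), (1, 1, 1)),
      Or.inr ⟨ρ, ⟨by linarith [hρ.1], hρ.2⟩, rfl⟩, compl _ ⟨by linarith, by linarith⟩ _
      (Or.inr ⟨ρ, ⟨by linarith [hρ.1], hρ.2⟩, rfl⟩) ?_, fun h s H => ?_⟩
    · simp only [tripleSum, id]; linear_combination (-1) * hρ'
    · have := hint h s H (-3 * (h ρ - s ρ * ρ)) (h 1 + (h ρ - s ρ * ρ)) (-s ρ)
        fun b hb => by linarith [H.tripleSum_le_support hb hρ]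
      refine this.trans (le_of_eq ?_)
      simp only [tripleSum, H.odd]
      linear_combination s ρ * hρ'
  push Not at hp1
  by_cases hnp : 3 * n + p ≤ 3
  · -- First form: the negative mass is spread evenly over all entries that are not `1`.
    have hρ' : (3 - p) * (n / (3 - p)) = n := by field_simp [(by linarith : 3 - p ≠ 0)]
    have hρ : n / (3 - p) ∈ Set.Icc (0 : ℝ) (1 / 3) :=
      ⟨div_nonneg hn0 (hn0.trans hn3), by rw [div_le_iff₀ (by linarith)]; linarith⟩
    set ρ := n / (3 - p)
    refine ⟨p, ⟨by linarith, by linarith⟩, ((-ρ, -ρ, -ρ), (-ρ, -ρ, 1)),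
      Or.inl (Or.inl ⟨ρ, hρ, rfl⟩), compl _ ⟨by linarith, by linarith⟩ _
      (Or.inl (Or.inl ⟨ρ, hρ, rfl⟩)) ?_, fun h s H => ?_⟩
    · simp only [tripleSum, id]; linear_combination (-1) * hρ'
    · have := hint h s H (-3 * (h ρ - s ρ * ρ)) (h 1 + (h ρ - s ρ * ρ)) (-s ρ)
        fun b hb => by linarith [H.tripleSum_le_support hb ⟨hρ.1, by linarith [hρ.2]⟩]
      refine this.trans (le_of_eq ?_)
      simp only [tripleSum, H.odd]
      linear_combination s ρ * hρ'
  · -- Second form: `(-1/3, -1/3, -1/3)` has weight `1 - p` and the rest is forced by the mean.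
    push Not at hnp
    have hp : 0 < p := by
      rcases hp0.eq_or_lt with h | h
      · rw [← h] at hn1 hnp; linarith
      · exact h
    have hρ' : 2 * p * ((n - 1 + p) / (2 * p)) = n - 1 + p := by field_simp
    have hρ : (n - 1 + p) / (2 * p) ∈ Set.Icc (1 / 3 : ℝ) 1 :=
      ⟨by rw [le_div_iff₀ (by linarith)]; linarith, by rw [div_le_one (by linarith)]; linarith⟩
    set ρ := (n - 1 + p) / (2 * p)
    refine ⟨p, ⟨by linarith, by linarith⟩, ((-1 / 3, -1 / 3, -1 / 3), (-ρ, -ρ, 1)),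
      Or.inl (Or.inr ⟨ρ, hρ, rfl⟩), compl _ ⟨by linarith, by linarith⟩ _
      (Or.inl (Or.inr ⟨ρ, hρ, rfl⟩)) ?_, fun h s H => ?_⟩
    · simp only [tripleSum, id]; linear_combination (-1) * hρ'
    · have := hint h s H (-3 * h (1 / 3) + s ρ)
        (h 1 + 3 * h (1 / 3) - 2 * (h ρ - s ρ * ρ) - s ρ) (-s ρ)
        fun b hb => by linarith [H.tripleSum_le_third hb hρ]
      refine this.trans (le_of_eq ?_)
      simp only [tripleSum, neg_div, H.odd]
      linear_combination s ρ * hρ'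

/-! ### Odd moments -/

theorem OddConvex.of_hasDerivAt (hodd : ∀ x, h (-x) = -h x) (hd : ∀ x, HasDerivAt h (s x) x)
    (hs : MonotoneOn s (Set.Icc 0 1)) : OddConvex h s := by
  have hc : Continuous h := continuous_iff_continuousAt.2 fun x => (hd x).continuousAt
  refine ⟨hc, hodd, fun x hx y hy => ?_⟩
  rcases lt_trichotomy x y with hxy | rfl | hxy
  · obtain ⟨z, hz, e⟩ := exists_hasDerivAt_eq_slope h s hxy hc.continuousOn fun x _ => hd x
    have := hs hx ⟨hx.1.trans hz.1.le, hz.2.le.trans hy.2⟩ hz.1.le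
    rw [e, le_div_iff₀ (sub_pos.2 hxy)] at this
    linarith
  · simp
  · obtain ⟨z, hz, e⟩ := exists_hasDerivAt_eq_slope h s hxy hc.continuousOn fun x _ => hd x
    have := hs ⟨hy.1.trans hz.1.le, hz.2.le.trans hx.2⟩ hx hz.2.le
    rw [e, div_le_iff₀ (sub_pos.2 hxy)] at this
    linarith

/-- The odd power `x ↦ x ^ (2 n + 1)`. -/
def oddPow (n : ℕ) (x : ℝ) : ℝ := x ^ (2 * n + 1)

theorem continuous_oddPow (n : ℕ) : Continuous (oddPow n) := by unfold oddPow; fun_prop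

theorem oddPow_neg (n : ℕ) (x : ℝ) : oddPow n (-x) = -oddPow n x :=
  Odd.neg_pow ⟨n, rfl⟩ x

theorem abs_oddPow_le_one (n : ℕ) {x : ℝ} (hx : x ∈ Set.Icc (-1 : ℝ) 1) : |oddPow n x| ≤ 1 := by
  rw [oddPow, abs_pow]
  exact pow_le_one₀ (abs_nonneg _) (abs_le.2 hx)

theorem hasDerivAt_oddPow (n : ℕ) (x : ℝ) :
    HasDerivAt (oddPow n) ((2 * n + 1) * (x ^ 2) ^ n) x := by
  have := hasDerivAt_pow (2 * n + 1) x
  simp only [Nat.add_sub_cancel, pow_mul] at this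
  exact_mod_cast this

theorem oddConvex_oddPow (n : ℕ) : OddConvex (oddPow n) fun x => (2 * n + 1) * (x ^ 2) ^ n := by
  refine OddConvex.of_hasDerivAt (oddPow_neg n) (hasDerivAt_oddPow n) fun x hx y hy hxy => ?_
  have := hx.1
  gcongr

theorem pow_sub_pow_le {u v : ℝ} (hu : 0 ≤ u) (huv : u ≤ v) (hv : v ≤ 1) {N l : ℕ} (hN : 1 ≤ N)
    (hl : N ≤ l) : v ^ l - u ^ l ≤ l * (v ^ N - u ^ N) := by
  have h0 : 0 ≤ v ^ N - u ^ N := sub_nonneg.2 (by gcongr)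
  induction l, hl using Nat.le_induction with
  | base =>
    have : (1 : ℝ) ≤ N := by exact_mod_cast hN
    nlinarith
  | succ l hl ih =>
    obtain ⟨M, rfl⟩ : ∃ M, N = M + 1 := ⟨N - 1, by omega⟩
    have e1 : u ^ l * (v - u) ≤ v ^ (M + 1) - u ^ (M + 1) := by
      have a1 : u ^ l ≤ u ^ M := pow_le_pow_of_le_one hu (huv.trans hv) (by omega)
      have a2 : u ^ M ≤ v ^ M := by gcongr
      have a3 := mul_le_mul_of_nonneg_right a1 (sub_nonneg.2 huv)
      have a4 := mul_le_mul_of_nonneg_right a2 (hu.trans huv)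
      rw [pow_succ, pow_succ]
      linarith
    have h1 : 0 ≤ v ^ l - u ^ l := sub_nonneg.2 (by gcongr)
    have e2 : v * (v ^ l - u ^ l) ≤ v ^ l - u ^ l := mul_le_of_le_one_left h1 hv
    push_cast
    rw [pow_succ, pow_succ]
    linarith

/-- On `[0, 1]`, a large multiple of a lower odd power (other than `x`) is more convex than
a higher one. -/
theorem oddConvex_sub {N l : ℕ} (hN : 1 ≤ N) (hl : N ≤ l) :
    OddConvex (fun x => (2 * l + 1) * l * oddPow N x - oddPow l x)
      fun x => (2 * l + 1) * l * ((2 * N + 1) * (x ^ 2) ^ N) - (2 * l + 1) * (x ^ 2) ^ l := by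
  refine OddConvex.of_hasDerivAt (fun x => by rw [oddPow_neg, oddPow_neg]; ring)
    (fun x => ((hasDerivAt_oddPow N x).const_mul _).sub (hasDerivAt_oddPow l x))
    fun x hx y hy hxy => ?_
  have hx0 := hx.1
  have h2 : x ^ 2 ≤ y ^ 2 := by gcongr
  have key := pow_sub_pow_le (sq_nonneg x) h2 (pow_le_one₀ hy.1 hy.2) hN hl
  have h0 : 0 ≤ (y ^ 2) ^ N - (x ^ 2) ^ N := sub_nonneg.2 (by gcongr)
  have e1 : (l : ℝ) * ((y ^ 2) ^ N - (x ^ 2) ^ N) ≤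
      l * ((2 * N + 1) * ((y ^ 2) ^ N - (x ^ 2) ^ N)) := by
    gcongr
    have : (0 : ℝ) ≤ N := by positivity
    nlinarith
  have := mul_le_mul_of_nonneg_left (key.trans e1) (by positivity : (0 : ℝ) ≤ 2 * l + 1)
  linarith

variable {D D' : Measure (ℝ × ℝ × ℝ)}

theorem integral_tripleSum_sub (hD : IsBiasDistribution D) {h k : ℝ → ℝ} (hh : Continuous h)
    (hk : Continuous k) : ∫ b, tripleSum (fun x => h x - k x) b ∂D =
      ∫ b, tripleSum h b ∂D - ∫ b, tripleSum k b ∂D := by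
  rw [← integral_sub (integrable_tripleSum hD hh) (integrable_tripleSum hD hk)]
  congr 1
  ext b
  simp only [tripleSum]
  ring

theorem integral_tripleSum_const_mul (C : ℝ) : ∫ b, tripleSum (fun x => C * h x) b ∂D =
    C * ∫ b, tripleSum h b ∂D := by
  rw [← integral_const_mul]
  congr 1
  ext b
  simp only [tripleSum]
  ring

/-- If the moments of order `2 l + 1` agree for all `l > N`, they agree for `l = N`:
`x ^ (2 N + 1)` differs from `x ^ (2 N + 1) * (1 - x ^ 2) ^ n`, which tends to `0`, by
a combination of higher odd powers. -/
theorem moment_eq_of_forall_gt (hD : IsBiasDistribution D) (hD' : IsBiasDistribution D') {N : ℕ}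
    (heq : ∀ l, N < l → ∫ b, tripleSum (oddPow l) b ∂D = ∫ b, tripleSum (oddPow l) b ∂D') :
    ∫ b, tripleSum (oddPow N) b ∂D = ∫ b, tripleSum (oddPow N) b ∂D' := by
  have := hD.1
  have := hD'.1
  let ψ : ℕ → ℕ → ℝ → ℝ := fun l n x => oddPow l x * (1 - x ^ 2) ^ n
  have hψc : ∀ l n, Continuous (ψ l n) := fun l n =>
    (continuous_oddPow l).mul (by fun_prop)
  have rec_fun : ∀ l n, ψ l (n + 1) = fun x => ψ l n x - ψ (l + 1) n x := by
    intro l n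
    ext x
    simp only [ψ, oddPow]
    ring
  have rec_int : ∀ {E : Measure (ℝ × ℝ × ℝ)}, IsBiasDistribution E → ∀ l n,
      ∫ b, tripleSum (ψ l (n + 1)) b ∂E =
        ∫ b, tripleSum (ψ l n) b ∂E - ∫ b, tripleSum (ψ (l + 1) n) b ∂E := fun hE l n => by
    rw [rec_fun, integral_tripleSum_sub hE (hψc _ _) (hψc _ _)]
  have hψ0 : ∀ l, ψ l 0 = oddPow l := fun l => by ext x; simp [ψ]
  have hhigh : ∀ n l, N < l →
      ∫ b, tripleSum (ψ l n) b ∂D = ∫ b, tripleSum (ψ l n) b ∂D' := by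
    intro n
    induction n with
    | zero => intro l hl; rw [hψ0]; exact heq l hl
    | succ n ih => intro l hl; rw [rec_int hD, rec_int hD', ih l hl, ih (l + 1) (by omega)]
  have hconst : ∀ n, ∫ b, tripleSum (ψ N n) b ∂D - ∫ b, tripleSum (ψ N n) b ∂D' =
      ∫ b, tripleSum (oddPow N) b ∂D - ∫ b, tripleSum (oddPow N) b ∂D' := by
    intro n
    induction n with
    | zero => rw [hψ0]
    | succ n ih => rw [rec_int hD, rec_int hD', hhigh n _ N.lt_succ_self, ← ih]; ring
  have hb : ∀ n, ∀ x ∈ Set.Icc (-1 : ℝ) 1, |ψ N n x| ≤ 1 := by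
    intro n x hx
    have h1 : x ^ 2 ≤ 1 := (sq_le_one_iff_abs_le_one x).2 (abs_le.2 hx)
    simp only [ψ, abs_mul]
    refine mul_le_one₀ (abs_oddPow_le_one N hx) (abs_nonneg _) ?_
    rw [abs_pow]
    exact pow_le_one₀ (abs_nonneg _) (abs_le.2 ⟨by linarith, by linarith [sq_nonneg x]⟩)
  have hlim : ∀ x ∈ Set.Icc (-1 : ℝ) 1,
      Filter.Tendsto (fun n => ψ N n x) Filter.atTop (nhds 0) := by
    intro x hx
    by_cases h0 : x = 0
    · simp [ψ, h0, oddPow]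
    · have h1 : x ^ 2 ≤ 1 := (sq_le_one_iff_abs_le_one x).2 (abs_le.2 hx)
      have h2 : 0 < x ^ 2 := by positivity
      have := (tendsto_pow_atTop_nhds_zero_of_lt_one (r := 1 - x ^ 2) (by linarith)
        (by linarith)).const_mul (oddPow N x)
      simpa [ψ] using this
  have hlimE : ∀ {E : Measure (ℝ × ℝ × ℝ)}, IsBiasDistribution E →
      Filter.Tendsto (fun n => ∫ b, tripleSum (ψ N n) b ∂E) Filter.atTop (nhds 0) := by
    intro E hE
    have := hE.1
    have := tendsto_integral_of_dominated_convergence (μ := E) (F := fun n => tripleSum (ψ N n))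
      (f := fun _ => 0) (fun _ => 3 * 1)
      (fun n => (measurable_tripleSum (hψc N n)).aestronglyMeasurable) (integrable_const _)
      (fun n => hE.2.mono fun b hb' => abs_tripleSum_le hb' (hb n))
      (hE.2.mono fun b hb' => by
        obtain ⟨h1, h2, h3⟩ := mem_Icc_of_mem_biasTriples hb'
        simpa [tripleSum] using ((hlim _ h1).add (hlim _ h2)).add (hlim _ h3))
    simpa using this
  have h0 := (hlimE hD).sub (hlimE hD')
  simp only [hconst, sub_zero] at h0
  exact sub_eq_zero.1 (tendsto_nhds_unique tendsto_const_nhds h0)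

/-- If `D'` dominates `D` and a single moment of odd order at least `3` agrees, then all
odd moments agree. -/
theorem moment_eq_of_dominated (hD : IsBiasDistribution D) (hD' : IsBiasDistribution D')
    (hdom : ∀ h s, OddConvex h s → ∫ b, tripleSum h b ∂D ≤ ∫ b, tripleSum h b ∂D')
    {N : ℕ} (hN : 1 ≤ N)
    (heq : ∫ b, tripleSum (oddPow N) b ∂D = ∫ b, tripleSum (oddPow N) b ∂D') (n : ℕ) :
    ∫ b, tripleSum (oddPow n) b ∂D = ∫ b, tripleSum (oddPow n) b ∂D' := by
  have hup : ∀ l, N ≤ l → ∫ b, tripleSum (oddPow l) b ∂D = ∫ b, tripleSum (oddPow l) b ∂D' := by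
    intro l hl
    refine le_antisymm (hdom _ _ (oddConvex_oddPow l)) ?_
    have := hdom _ _ (oddConvex_sub hN hl)
    rw [integral_tripleSum_sub hD ((continuous_oddPow N).const_mul _) (continuous_oddPow l),
      integral_tripleSum_sub hD' ((continuous_oddPow N).const_mul _) (continuous_oddPow l),
      integral_tripleSum_const_mul, integral_tripleSum_const_mul, heq] at this
    linarith
  have hdown : ∀ k, k ≤ N → ∀ l, N - k ≤ l →
      ∫ b, tripleSum (oddPow l) b ∂D = ∫ b, tripleSum (oddPow l) b ∂D' := by
    intro k
    induction k with
    | zero => intro _ l hl; exact hup l (by omega)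
    | succ k ih =>
      intro hk l hl
      rcases hl.eq_or_lt with rfl | hl
      · exact moment_eq_of_forall_gt hD hD' fun l hl => ih (by omega) l (by omega)
      · exact ih (by omega) l (by omega)
  exact hdown N le_rfl n (by omega)

/-! ### Odd power series with nonnegative coefficients -/

/-- `F` is the sum on `[-1, 1]` of an odd power series with nonnegative coefficients `a`. -/
structure IsOddSeries (F : ℝ → ℝ) (a : ℕ → ℝ) : Prop where
  nonneg : ∀ n, 0 ≤ a n
  hasSum : ∀ x ∈ Set.Icc (-1 : ℝ) 1, HasSum (fun n => a n * oddPow n x) (F x)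

variable {F : ℝ → ℝ} {a : ℕ → ℝ}

theorem IsOddSeries.summable (hF : IsOddSeries F a) : Summable a := by
  have := (hF.hasSum 1 ⟨by norm_num, le_rfl⟩).summable
  simpa [oddPow] using this

theorem IsOddSeries.norm_le (hF : IsOddSeries F a) (n : ℕ) {x : ℝ} (hx : x ∈ Set.Icc (-1 : ℝ) 1) :
    ‖a n * oddPow n x‖ ≤ a n := by
  rw [norm_mul, Real.norm_of_nonneg (hF.nonneg n)]
  exact mul_le_of_le_one_right (hF.nonneg n) (abs_oddPow_le_one n hx)

theorem IsOddSeries.continuousOn (hF : IsOddSeries F a) : ContinuousOn F (Set.Icc (-1) 1) := by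
  have := continuousOn_tsum (s := Set.Icc (-1 : ℝ) 1) (f := fun n x => a n * oddPow n x)
    (fun n => ((continuous_oddPow n).const_mul _).continuousOn) hF.summable
    fun n x hx => hF.norm_le n hx
  exact this.congr fun x hx => ((hF.hasSum x hx).tsum_eq).symm

theorem IsOddSeries.hasSum_integral (hF : IsOddSeries F a) (hD : IsBiasDistribution D) :
    HasSum (fun n => a n * ∫ b, tripleSum (oddPow n) b ∂D) (∫ b, tripleSum F b ∂D) := by
  have := hD.1
  have key := hasSum_integral_of_dominated_convergence (μ := D)
    (F := fun n b => a n * tripleSum (oddPow n) b) (f := tripleSum F) (fun n _ => a n * (3 * 1))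
    (fun n => ((measurable_tripleSum (continuous_oddPow n)).const_mul _).aestronglyMeasurable)
    (fun n => hD.2.mono fun b hb => by
      rw [norm_mul, Real.norm_of_nonneg (hF.nonneg n)]
      exact mul_le_mul_of_nonneg_left (abs_tripleSum_le hb fun x hx => abs_oddPow_le_one n hx)
        (hF.nonneg n))
    (Filter.Eventually.of_forall fun b => hF.summable.mul_right _) (integrable_const _)
    (hD.2.mono fun b hb => by
      obtain ⟨h1, h2, h3⟩ := mem_Icc_of_mem_biasTriples hb
      have := ((hF.hasSum _ h1).add (hF.hasSum _ h2)).add (hF.hasSum _ h3)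
      simpa only [tripleSum, mul_add] using this)
  simpa only [integral_const_mul] using key

theorem IsOddSeries.integral_le_of_dominated (hF : IsOddSeries F a) (hD : IsBiasDistribution D)
    (hD' : IsBiasDistribution D')
    (hdom : ∀ h s, OddConvex h s → ∫ b, tripleSum h b ∂D ≤ ∫ b, tripleSum h b ∂D') :
    ∫ b, tripleSum F b ∂D ≤ ∫ b, tripleSum F b ∂D' :=
  hasSum_le (fun n => mul_le_mul_of_nonneg_left (hdom _ _ (oddConvex_oddPow n)) (hF.nonneg n))
    (hF.hasSum_integral hD) (hF.hasSum_integral hD')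

/-- If `D'` dominates `D` and the two integrals of a nonlinear odd series with nonnegative
coefficients agree, then all odd moments agree. -/
theorem IsOddSeries.moment_eq_of_dominated (hF : IsOddSeries F a) (hD : IsBiasDistribution D)
    (hD' : IsBiasDistribution D')
    (hdom : ∀ h s, OddConvex h s → ∫ b, tripleSum h b ∂D ≤ ∫ b, tripleSum h b ∂D')
    {N : ℕ} (hN : 1 ≤ N) (ha : a N ≠ 0)
    (heq : ∫ b, tripleSum F b ∂D = ∫ b, tripleSum F b ∂D') (n : ℕ) :
    ∫ b, tripleSum (oddPow n) b ∂D = ∫ b, tripleSum (oddPow n) b ∂D' := by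
  have hs := (hF.hasSum_integral hD').sub (hF.hasSum_integral hD)
  rw [heq, sub_self] at hs
  have h0 := (hasSum_zero_iff_of_nonneg fun n => sub_nonneg.2 <|
    mul_le_mul_of_nonneg_left (hdom _ _ (oddConvex_oddPow n)) (hF.nonneg n)).1 hs
  have hN0 := congrFun h0 N
  simp only [Pi.zero_apply, ← mul_sub, mul_eq_zero, ha, false_or] at hN0
  exact NAE3.moment_eq_of_dominated hD hD' hdom hN (sub_eq_zero.1 hN0).symm n

end

section

/-! ### Gaussian integrals of sines and cosines -/

instance isProbabilityMeasure_stdGauss (d : ℕ) : IsProbabilityMeasure (stdGauss d) := by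
  unfold stdGauss; infer_instance

variable {d : ℕ}

theorem integral_cexp_dotProduct (a : Fin d → ℝ) :
    ∫ x, Complex.exp ((a ⬝ᵥ x : ℝ) * Complex.I) ∂(stdGauss d) =
      Complex.exp ((-(a ⬝ᵥ a) / 2 : ℝ)) := by
  have e : ∀ x : Fin d → ℝ, Complex.exp ((a ⬝ᵥ x : ℝ) * Complex.I) =
      ∏ j, Complex.exp (a j * x j * Complex.I) := fun x => by
    rw [← Complex.exp_sum, ← Finset.sum_mul]
    simp [dotProduct]
  simp only [e, stdGauss]
  rw [integral_fintype_prod_eq_prod (𝕜 := ℂ)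
    (f := fun j (y : ℝ) => Complex.exp (a j * y * Complex.I))]
  have h1 : ∀ j, ∫ y : ℝ, Complex.exp (a j * y * Complex.I) ∂(gaussianReal 0 1) =
      Complex.exp ((-(a j * a j) / 2 : ℝ)) := fun j => by
    rw [← charFun_apply_real, charFun_gaussianReal]
    congr 1
    push_cast
    simp
    ring
  simp only [h1]
  rw [← Complex.exp_sum]
  congr 1
  simp [dotProduct, Finset.sum_div, neg_div]

theorem measurable_dotProduct (a : Fin d → ℝ) : Measurable fun x : Fin d → ℝ => a ⬝ᵥ x := by
  unfold dotProduct; fun_prop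

theorem continuous_dotProduct (a : Fin d → ℝ) : Continuous fun x : Fin d → ℝ => a ⬝ᵥ x := by
  unfold dotProduct; fun_prop

theorem integral_cos_dotProduct (a : Fin d → ℝ) :
    ∫ x, Real.cos (a ⬝ᵥ x) ∂(stdGauss d) = Real.exp (-(a ⬝ᵥ a) / 2) := by
  have hi : Integrable (fun x => Complex.exp ((a ⬝ᵥ x : ℝ) * Complex.I)) (stdGauss d) :=
    Integrable.of_bound (by have := continuous_dotProduct a; fun_prop) 1
      (Filter.Eventually.of_forall fun x => by rw [Complex.norm_exp_ofReal_mul_I])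
  have := integral_re hi
  rw [integral_cexp_dotProduct, ← Complex.ofReal_exp] at this
  simpa only [RCLike.re_to_complex, Complex.exp_ofReal_mul_I_re, Complex.ofReal_re] using this

theorem integral_sin_dotProduct (a : Fin d → ℝ) :
    ∫ x, Real.sin (a ⬝ᵥ x) ∂(stdGauss d) = 0 := by
  have hi : Integrable (fun x => Complex.exp ((a ⬝ᵥ x : ℝ) * Complex.I)) (stdGauss d) :=
    Integrable.of_bound (by have := continuous_dotProduct a; fun_prop) 1
      (Filter.Eventually.of_forall fun x => by rw [Complex.norm_exp_ofReal_mul_I])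
  have := integral_im hi
  rw [integral_cexp_dotProduct, ← Complex.ofReal_exp] at this
  simpa only [RCLike.im_to_complex, Complex.exp_ofReal_mul_I_im, Complex.ofReal_im] using this

theorem dual_apply_eq_dotProduct (L : StrongDual ℝ (Fin d → ℝ)) (x : Fin d → ℝ) :
    L x = (fun j => L (Pi.single j 1)) ⬝ᵥ x := by
  conv_lhs => rw [← Finset.univ_sum_single x]
  rw [map_sum, dotProduct]
  refine Finset.sum_congr rfl fun j _ => ?_
  rw [show (Pi.single j (x j) : Fin d → ℝ) = x j • Pi.single j 1 by
    rw [← Pi.single_smul, smul_eq_mul, mul_one], map_smul, smul_eq_mul, mul_comm]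

theorem charFunDual_stdGauss (L : StrongDual ℝ (Fin d → ℝ)) : charFunDual (stdGauss d) L =
    Complex.exp ((-∑ j, L (Pi.single j 1) ^ 2 / 2 : ℝ)) := by
  rw [charFunDual_apply]
  refine ((integral_congr_ae (Filter.Eventually.of_forall fun x =>
    congrArg (fun r : ℝ => Complex.exp (r * Complex.I)) (dual_apply_eq_dotProduct L x))).trans
    (integral_cexp_dotProduct _)).trans ?_
  congr 2
  simp [dotProduct, Finset.sum_div, sq, neg_div]

/-- The law of `v = ρ z + √(1 - ρ²) w` is standard Gaussian. -/
theorem measurePreserving_mix {ρ : ℝ} (hρ : ρ ∈ Set.Icc (-1 : ℝ) 1) :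
    MeasurePreserving (fun q : (Fin d → ℝ) × (Fin d → ℝ) => ρ • q.1 + √(1 - ρ ^ 2) • q.2)
      ((stdGauss d).prod (stdGauss d)) (stdGauss d) := by
  let T : (Fin d → ℝ) × (Fin d → ℝ) →L[ℝ] (Fin d → ℝ) :=
    ρ • ContinuousLinearMap.fst ℝ _ _ + √(1 - ρ ^ 2) • ContinuousLinearMap.snd ℝ _ _
  have hT : ∀ q, T q = ρ • q.1 + √(1 - ρ ^ 2) • q.2 := fun q => rfl
  refine ⟨T.continuous.measurable, ?_⟩
  change Measure.map T _ = _
  have : IsFiniteMeasure (Measure.map T ((stdGauss d).prod (stdGauss d))) := inferInstance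
  refine Measure.ext_of_charFunDual (funext fun L => ?_)
  rw [charFunDual_map, charFunDual_prod, charFunDual_stdGauss, charFunDual_stdGauss,
    charFunDual_stdGauss, ← Complex.exp_add, ← Complex.ofReal_add]
  congr 2
  have hs : √(1 - ρ ^ 2) ^ 2 = 1 - ρ ^ 2 :=
    Real.sq_sqrt (sub_nonneg.2 ((sq_le_one_iff_abs_le_one ρ).2 (abs_le.2 hρ)))
  rw [← neg_add, ← Finset.sum_add_distrib]
  congr 1
  refine Finset.sum_congr rfl fun j _ => ?_
  simp [hT, mul_pow, hs]
  ring

theorem measurePreserving_neg : MeasurePreserving (fun x : Fin d → ℝ => -x)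
    (stdGauss d) (stdGauss d) := by
  let T : (Fin d → ℝ) →L[ℝ] (Fin d → ℝ) := -ContinuousLinearMap.id ℝ _
  refine ⟨measurable_neg, ?_⟩
  change Measure.map T _ = _
  have : IsFiniteMeasure (Measure.map T (stdGauss d)) := inferInstance
  refine Measure.ext_of_charFunDual (funext fun L => ?_)
  rw [charFunDual_map, charFunDual_stdGauss, charFunDual_stdGauss]
  simp [T]

theorem map_dotProduct (a : Fin d → ℝ) : (stdGauss d).map (fun x => a ⬝ᵥ x) =
    gaussianReal 0 (a ⬝ᵥ a).toNNReal := by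
  have : IsProbabilityMeasure ((stdGauss d).map (fun x => a ⬝ᵥ x)) :=
    Measure.isProbabilityMeasure_map (measurable_dotProduct a).aemeasurable
  refine Measure.ext_of_charFun (funext fun t => ?_)
  rw [charFun_apply_real, integral_map (measurable_dotProduct a).aemeasurable (by fun_prop),
    charFun_gaussianReal]
  have := integral_cexp_dotProduct (t • a)
  simp only [smul_dotProduct, dotProduct_smul, smul_eq_mul] at this
  push_cast at this
  have hnn : 0 ≤ a ⬝ᵥ a := Finset.sum_nonneg fun _ _ => mul_self_nonneg _
  rw [this, Real.coe_toNNReal _ hnn]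
  congr 1
  push_cast
  ring

theorem integrable_of_bound {Ω : Type*} [MeasurableSpace Ω] {μ : Measure Ω} [IsFiniteMeasure μ]
    {g : Ω → ℝ} (hg : Measurable g) (C : ℝ) (hC : ∀ x, |g x| ≤ C) : Integrable g μ :=
  Integrable.of_bound hg.aestronglyMeasurable C (Filter.Eventually.of_forall hC)

theorem integral_cos_add (a b : Fin d → ℝ) :
    ∫ q, Real.cos (a ⬝ᵥ q.1 + b ⬝ᵥ q.2) ∂((stdGauss d).prod (stdGauss d)) =
      Real.exp (-(a ⬝ᵥ a + b ⬝ᵥ b) / 2) := by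
  have ma := measurable_dotProduct a
  have mb := measurable_dotProduct b
  simp only [Real.cos_add]
  rw [integral_sub, integral_prod_mul (fun x => Real.cos (a ⬝ᵥ x)) (fun x => Real.cos (b ⬝ᵥ x)),
    integral_prod_mul (fun x => Real.sin (a ⬝ᵥ x)) (fun x => Real.sin (b ⬝ᵥ x)),
    integral_cos_dotProduct, integral_cos_dotProduct, integral_sin_dotProduct, zero_mul, sub_zero,
    ← Real.exp_add]
  · congr 1; ring
  · exact integrable_of_bound (by fun_prop) 1 fun q => by
      rw [abs_mul]; exact mul_le_one₀ (Real.abs_cos_le_one _) (abs_nonneg _) (Real.abs_cos_le_one _)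
  · exact integrable_of_bound (by fun_prop) 1 fun q => by
      rw [abs_mul]; exact mul_le_one₀ (Real.abs_sin_le_one _) (abs_nonneg _) (Real.abs_sin_le_one _)

theorem measurable_mix (ρ : ℝ) : Measurable
    fun q : (Fin d → ℝ) × (Fin d → ℝ) => ρ • q.1 + √(1 - ρ ^ 2) • q.2 := by
  fun_prop

/-- The covariance of two sines at `ρ`-correlated Gaussians. -/
theorem integral_sin_mul_sin {ρ : ℝ} (hρ : ρ ∈ Set.Icc (-1 : ℝ) 1) (ξ η : Fin d → ℝ) :
    ∫ q : (Fin d → ℝ) × (Fin d → ℝ),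
      Real.sin (ξ ⬝ᵥ q.1) * Real.sin (η ⬝ᵥ (ρ • q.1 + √(1 - ρ ^ 2) • q.2))
        ∂((stdGauss d).prod (stdGauss d)) =
      Real.exp (-(ξ ⬝ᵥ ξ) / 2) * Real.exp (-(η ⬝ᵥ η) / 2) * Real.sinh (ρ * (ξ ⬝ᵥ η)) := by
  have hs : √(1 - ρ ^ 2) * √(1 - ρ ^ 2) = 1 - ρ ^ 2 :=
    Real.mul_self_sqrt (sub_nonneg.2 ((sq_le_one_iff_abs_le_one ρ).2 (abs_le.2 hρ)))
  set t := √(1 - ρ ^ 2)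
  have e : ∀ q : (Fin d → ℝ) × (Fin d → ℝ),
      Real.sin (ξ ⬝ᵥ q.1) * Real.sin (η ⬝ᵥ (ρ • q.1 + t • q.2)) =
      1 / 2 * Real.cos ((ξ - ρ • η) ⬝ᵥ q.1 + (-t • η) ⬝ᵥ q.2) -
        1 / 2 * Real.cos ((ξ + ρ • η) ⬝ᵥ q.1 + (t • η) ⬝ᵥ q.2) := by
    intro q
    have e1 : (ξ - ρ • η) ⬝ᵥ q.1 + (-t • η) ⬝ᵥ q.2 =
        ξ ⬝ᵥ q.1 - η ⬝ᵥ (ρ • q.1 + t • q.2) := by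
      simp only [sub_dotProduct, smul_dotProduct, dotProduct_add, dotProduct_smul, smul_eq_mul]
      ring
    have e2 : (ξ + ρ • η) ⬝ᵥ q.1 + (t • η) ⬝ᵥ q.2 =
        ξ ⬝ᵥ q.1 + η ⬝ᵥ (ρ • q.1 + t • q.2) := by
      simp only [add_dotProduct, smul_dotProduct, dotProduct_add, dotProduct_smul, smul_eq_mul]
      ring
    rw [e1, e2, Real.cos_sub, Real.cos_add]
    ring
  have hi : ∀ a b : Fin d → ℝ, Integrable (fun q : (Fin d → ℝ) × (Fin d → ℝ) =>
      1 / 2 * Real.cos (a ⬝ᵥ q.1 + b ⬝ᵥ q.2)) ((stdGauss d).prod (stdGauss d)) := fun a b => by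
    have ma := measurable_dotProduct a
    have mb := measurable_dotProduct b
    exact (integrable_of_bound (by fun_prop) 1 fun q => Real.abs_cos_le_one _).const_mul _
  simp only [e]
  rw [integral_sub (hi _ _) (hi _ _), integral_const_mul, integral_const_mul, integral_cos_add,
    integral_cos_add, Real.sinh_eq, ← Real.exp_add]
  have c1 : -((ξ - ρ • η) ⬝ᵥ (ξ - ρ • η) + (-t • η) ⬝ᵥ (-t • η)) / 2 =
      (-(ξ ⬝ᵥ ξ) / 2 + -(η ⬝ᵥ η) / 2) + ρ * (ξ ⬝ᵥ η) := by
    simp only [sub_dotProduct, dotProduct_sub, smul_dotProduct, dotProduct_smul, smul_eq_mul,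
      dotProduct_comm η ξ]
    linear_combination (-(η ⬝ᵥ η) / 2) * hs
  have c2 : -((ξ + ρ • η) ⬝ᵥ (ξ + ρ • η) + (t • η) ⬝ᵥ (t • η)) / 2 =
      (-(ξ ⬝ᵥ ξ) / 2 + -(η ⬝ᵥ η) / 2) + -(ρ * (ξ ⬝ᵥ η)) := by
    simp only [add_dotProduct, dotProduct_add, smul_dotProduct, dotProduct_smul, smul_eq_mul,
      dotProduct_comm η ξ]
    linear_combination (-(η ⬝ᵥ η) / 2) * hs
  rw [c1, c2, Real.exp_add _ (ρ * _), Real.exp_add _ (-(ρ * _))]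
  ring

theorem integrable_dotProduct_sq (a : Fin d → ℝ) :
    Integrable (fun x => (a ⬝ᵥ x) ^ 2) (stdGauss d) ∧
      ∫ x, (a ⬝ᵥ x) ^ 2 ∂(stdGauss d) = a ⬝ᵥ a := by
  have hm := measurable_dotProduct a
  have hnn : 0 ≤ a ⬝ᵥ a := Finset.sum_nonneg fun _ _ => mul_self_nonneg _
  have hL : MemLp id 2 (gaussianReal 0 (a ⬝ᵥ a).toNNReal) := memLp_id_gaussianReal 2
  constructor
  · rw [← map_dotProduct] at hL
    exact (hL.comp_of_map hm.aemeasurable).integrable_sq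
  · have e := variance_id_gaussianReal (μ := 0) (v := (a ⬝ᵥ a).toNNReal)
    rw [variance_eq_integral aemeasurable_id] at e
    simp only [id, integral_id_gaussianReal, sub_zero] at e
    rw [← map_dotProduct, integral_map hm.aemeasurable (by fun_prop), Real.coe_toNNReal _ hnn] at e
    exact e

theorem integrable_dotProduct (a : Fin d → ℝ) :
    Integrable (fun x => a ⬝ᵥ x) (stdGauss d) := by
  have hL : MemLp (fun x => a ⬝ᵥ x) 2 (stdGauss d) :=
    (memLp_two_iff_integrable_sq (measurable_dotProduct a).aestronglyMeasurable).2
      (integrable_dotProduct_sq a).1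
  exact hL.integrable (by norm_num)

/-- The correlation of a linear function with a sine, by differentiating
`t ↦ 𝔼[cos ((ξ + t a) ⬝ x)]` at `0`. -/
theorem integral_dotProduct_mul_sin (a ξ : Fin d → ℝ) :
    ∫ x, (a ⬝ᵥ x) * Real.sin (ξ ⬝ᵥ x) ∂(stdGauss d) =
      Real.exp (-(ξ ⬝ᵥ ξ) / 2) * (a ⬝ᵥ ξ) := by
  have ma := measurable_dotProduct a
  have mξ := measurable_dotProduct ξ
  have key := hasDerivAt_integral_of_dominated_loc_of_deriv_le (μ := stdGauss d) (𝕜 := ℝ)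
    (F := fun (t : ℝ) x => Real.cos (ξ ⬝ᵥ x + t * (a ⬝ᵥ x)))
    (F' := fun (t : ℝ) x => -Real.sin (ξ ⬝ᵥ x + t * (a ⬝ᵥ x)) * (a ⬝ᵥ x))
    (x₀ := 0) (s := Set.univ) (bound := fun x => |a ⬝ᵥ x|) Filter.univ_mem
    (Filter.Eventually.of_forall fun t => Measurable.aestronglyMeasurable (by fun_prop))
    (integrable_of_bound (by fun_prop) 1 fun x => Real.abs_cos_le_one _)
    (Measurable.aestronglyMeasurable (by fun_prop))
    (Filter.Eventually.of_forall fun x t _ => by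
      rw [norm_mul, norm_neg, Real.norm_eq_abs, Real.norm_eq_abs]
      exact mul_le_of_le_one_left (abs_nonneg _) (Real.abs_sin_le_one _))
    (integrable_dotProduct a).abs
    (Filter.Eventually.of_forall fun x t _ => by
      have := ((hasDerivAt_id t).mul_const (a ⬝ᵥ x)).const_add (ξ ⬝ᵥ x)
      simpa using this.cos)
  have e : ∀ t : ℝ, ∫ x, Real.cos (ξ ⬝ᵥ x + t * (a ⬝ᵥ x)) ∂(stdGauss d) =
      Real.exp (-(ξ ⬝ᵥ ξ + 2 * (a ⬝ᵥ ξ) * t + (a ⬝ᵥ a) * t ^ 2) / 2) := by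
    intro t
    have := integral_cos_dotProduct (ξ + t • a)
    simp only [add_dotProduct, dotProduct_add, smul_dotProduct, dotProduct_smul, smul_eq_mul,
      dotProduct_comm ξ a] at this
    rw [this]
    congr 1
    ring
  have key2 : HasDerivAt (fun t : ℝ => ∫ x, Real.cos (ξ ⬝ᵥ x + t * (a ⬝ᵥ x)) ∂(stdGauss d))
      (∫ x, -Real.sin (ξ ⬝ᵥ x + 0 * (a ⬝ᵥ x)) * (a ⬝ᵥ x) ∂(stdGauss d)) 0 := key.2
  simp only [e] at key2
  have d2 : HasDerivAt (fun t : ℝ => Real.exp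
      (-(ξ ⬝ᵥ ξ + 2 * (a ⬝ᵥ ξ) * t + (a ⬝ᵥ a) * t ^ 2) / 2))
      (Real.exp (-(ξ ⬝ᵥ ξ) / 2) * (-(a ⬝ᵥ ξ))) 0 := by
    have i1 : HasDerivAt (fun t : ℝ => -(ξ ⬝ᵥ ξ + 2 * (a ⬝ᵥ ξ) * t + (a ⬝ᵥ a) * t ^ 2) / 2)
        (-(a ⬝ᵥ ξ)) 0 := by
      have := (((((hasDerivAt_id (0 : ℝ)).const_mul (2 * (a ⬝ᵥ ξ))).const_add (ξ ⬝ᵥ ξ)).add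
        ((hasDerivAt_pow 2 (0 : ℝ)).const_mul (a ⬝ᵥ a))).neg).div_const 2
      refine HasDerivAt.congr_deriv (f := fun t : ℝ =>
        -(ξ ⬝ᵥ ξ + 2 * (a ⬝ᵥ ξ) * t + (a ⬝ᵥ a) * t ^ 2) / 2) this ?_
      simp
      ring
    simpa using i1.exp
  have := key2.unique d2
  simp only [zero_mul, add_zero, neg_mul, integral_neg, mul_neg, neg_inj] at this
  rw [← this]
  congr 1
  ext x
  ring

end

section

variable {d : ℕ}

/-! ### Density of sines among the odd functions -/

theorem integral_comp_neg_stdGauss (g : (Fin d → ℝ) → ℝ) :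
    ∫ x, g (-x) ∂(stdGauss d) = ∫ x, g x ∂(stdGauss d) :=
  measurePreserving_neg.integral_comp (Homeomorph.neg (Fin d → ℝ)).measurableEmbedding g

theorem integrable_comp_neg_stdGauss {g : (Fin d → ℝ) → ℝ} (hg : Integrable g (stdGauss d)) :
    Integrable (fun x => g (-x)) (stdGauss d) :=
  measurePreserving_neg.integrable_comp_of_integrable hg

theorem integrable_mul_of_bound {Ω : Type*} [MeasurableSpace Ω] {μ : Measure Ω} {k g : Ω → ℝ}
    (hk : Integrable k μ) (hg : Measurable g) (C : ℝ) (hC : ∀ x, |g x| ≤ C) :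
    Integrable (fun x => k x * g x) μ :=
  hk.mul_bdd hg.aestronglyMeasurable (Filter.Eventually.of_forall hC)

/-- Injectivity of the characteristic function, applied to the positive and the negative part. -/
theorem ae_eq_zero_of_integral_trig {k : (Fin d → ℝ) → ℝ} (hm : Measurable k)
    (hk : Integrable k (stdGauss d))
    (hcos : ∀ ξ : Fin d → ℝ, ∫ x, k x * Real.cos (ξ ⬝ᵥ x) ∂(stdGauss d) = 0)
    (hsin : ∀ ξ : Fin d → ℝ, ∫ x, k x * Real.sin (ξ ⬝ᵥ x) ∂(stdGauss d) = 0) :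
    k =ᵐ[stdGauss d] 0 := by
  have f1 : IsFiniteMeasure ((stdGauss d).withDensity fun x => ENNReal.ofReal (k x)) :=
    isFiniteMeasure_withDensity_ofReal hk.2
  have f2 : IsFiniteMeasure ((stdGauss d).withDensity fun x => ENNReal.ofReal (-k x)) :=
    isFiniteMeasure_withDensity_ofReal hk.neg.2
  have heq : (stdGauss d).withDensity (fun x => ENNReal.ofReal (k x)) =
      (stdGauss d).withDensity (fun x => ENNReal.ofReal (-k x)) := by
    refine Measure.ext_of_charFunDual (funext fun L => ?_)
    rw [charFunDual_apply, charFunDual_apply,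
      integral_withDensity_eq_integral_toReal_smul (by fun_prop) (by simp),
      integral_withDensity_eq_integral_toReal_smul (by fun_prop) (by simp), ← sub_eq_zero]
    have hi : ∀ g : (Fin d → ℝ) → ℝ, Integrable g (stdGauss d) →
        Integrable (fun x => g x • Complex.exp (L x * Complex.I)) (stdGauss d) := fun g hg => by
      simp only [Complex.real_smul]
      exact hg.ofReal.mul_bdd (c := 1) (Continuous.aestronglyMeasurable (by fun_prop))
        (Filter.Eventually.of_forall fun x => by rw [Complex.norm_exp_ofReal_mul_I])
    simp only [ENNReal.toReal_ofReal']
    rw [← integral_sub (hi _ hk.pos_part) (hi _ hk.neg_part)]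
    set ξ : Fin d → ℝ := fun j => L (Pi.single j 1)
    have e : ∀ x, max (k x) 0 • Complex.exp (L x * Complex.I) -
        max (-k x) 0 • Complex.exp (L x * Complex.I) =
        ((k x * Real.cos (ξ ⬝ᵥ x) : ℝ) : ℂ) + ((k x * Real.sin (ξ ⬝ᵥ x) : ℝ) : ℂ) * Complex.I := by
      intro x
      have e0 : max (k x) 0 - max (-k x) 0 = k x := by
        rcases le_total (k x) 0 with h | h <;> simp [h]
      rw [← sub_smul, e0, dual_apply_eq_dotProduct L x, Complex.exp_mul_I, Complex.real_smul]
      push_cast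
      ring
    have ic : Integrable (fun x => k x * Real.cos (ξ ⬝ᵥ x)) (stdGauss d) :=
      integrable_mul_of_bound hk (Real.continuous_cos.measurable.comp (measurable_dotProduct ξ)) 1
        fun x => Real.abs_cos_le_one _
    have is : Integrable (fun x => k x * Real.sin (ξ ⬝ᵥ x)) (stdGauss d) :=
      integrable_mul_of_bound hk (Real.continuous_sin.measurable.comp (measurable_dotProduct ξ)) 1
        fun x => Real.abs_sin_le_one _
    simp only [e]
    rw [integral_add ic.ofReal (is.ofReal.mul_const _), integral_mul_const, integral_complex_ofReal,
      integral_complex_ofReal, hcos, hsin]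
    simp
  rw [withDensity_eq_iff_of_sigmaFinite (by fun_prop) (by fun_prop)] at heq
  filter_upwards [heq] with x hx
  rcases le_total (k x) 0 with h | h
  · rw [ENNReal.ofReal_of_nonpos h, eq_comm, ENNReal.ofReal_eq_zero] at hx
    exact le_antisymm h (by simpa using hx)
  · rw [ENNReal.ofReal_of_nonpos (neg_nonpos.2 h), ENNReal.ofReal_eq_zero] at hx
    exact le_antisymm hx h

/-- The finite combination `∑ c ξ sin (ξ ⬝ x)` of sines with frequencies `ξ` in `s`. -/
def sineSum (s : Finset (Fin d → ℝ)) (c : (Fin d → ℝ) → ℝ) (x : Fin d → ℝ) : ℝ :=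
  ∑ ξ ∈ s, c ξ * Real.sin (ξ ⬝ᵥ x)

theorem continuous_sineSum (s : Finset (Fin d → ℝ)) (c : (Fin d → ℝ) → ℝ) :
    Continuous (sineSum s c) :=
  continuous_finsetSum _ fun ξ _ =>
    continuous_const.mul (Real.continuous_sin.comp (continuous_dotProduct ξ))

theorem abs_sineSum_le (s : Finset (Fin d → ℝ)) (c : (Fin d → ℝ) → ℝ) (x : Fin d → ℝ) :
    |sineSum s c x| ≤ ∑ ξ ∈ s, |c ξ| :=
  (Finset.abs_sum_le_sum_abs _ _).trans <| Finset.sum_le_sum fun ξ _ => by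
    rw [abs_mul]
    exact mul_le_of_le_one_right (abs_nonneg _) (Real.abs_sin_le_one _)

theorem IsRounding.abs_le_one {f : (Fin d → ℝ) → ℝ} (hf : IsRounding f) (x : Fin d → ℝ) :
    |f x| ≤ 1 := abs_le.2 (hf.mem_Icc x)

/-- An odd function in `L²` is orthogonal to whatever is orthogonal to all sines, so it is
a limit of combinations of sines. -/
theorem IsRounding.exists_sineSum {f : (Fin d → ℝ) → ℝ} (hf : IsRounding f) {ε : ℝ}
    (hε : 0 < ε) : ∃ s c, ∫ x, (f x - sineSum s c x) ^ 2 ∂(stdGauss d) ≤ ε ^ 2 := by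
  have memLp_bdd : ∀ g : (Fin d → ℝ) → ℝ, Measurable g → ∀ C, (∀ x, |g x| ≤ C) →
      MemLp g 2 (stdGauss d) := fun g hg C hC =>
    MemLp.of_bound hg.aestronglyMeasurable C (Filter.Eventually.of_forall hC)
  have msin : ∀ ξ : Fin d → ℝ, MemLp (fun x => Real.sin (ξ ⬝ᵥ x)) 2 (stdGauss d) := fun ξ =>
    memLp_bdd _ (Real.continuous_sin.measurable.comp (measurable_dotProduct ξ)) 1
      fun x => Real.abs_sin_le_one _
  have mf : MemLp f 2 (stdGauss d) := memLp_bdd f hf.measurable 1 hf.abs_le_one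
  let S : (Fin d → ℝ) → Lp ℝ 2 (stdGauss d) := fun ξ => (msin ξ).toLp
  let K : Submodule ℝ (Lp ℝ 2 (stdGauss d)) := Submodule.span ℝ (Set.range S)
  have hmem : mf.toLp ∈ K.topologicalClosure := by
    rw [← Submodule.orthogonal_orthogonal_eq_closure, Submodule.mem_orthogonal]
    intro h hh
    rw [Submodule.mem_orthogonal'] at hh
    have hm : Measurable h := (Lp.stronglyMeasurable h).measurable
    have hi : Integrable h (stdGauss d) := (Lp.memLp h).integrable (by norm_num)
    have hsin : ∀ ξ : Fin d → ℝ, ∫ x, h x * Real.sin (ξ ⬝ᵥ x) ∂(stdGauss d) = 0 := fun ξ => by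
      have := hh (S ξ) (Submodule.subset_span ⟨ξ, rfl⟩)
      rw [L2.inner_def] at this
      rw [← this]
      refine integral_congr_ae ?_
      filter_upwards [(msin ξ).coeFn_toLp] with x hx
      simp [S, hx, mul_comm]
    have hmul : ∀ g : (Fin d → ℝ) → ℝ, Measurable g → (∀ x, |g x| ≤ 1) →
        ∫ x, (h x - h (-x)) * g x ∂(stdGauss d) =
          ∫ x, h x * g x ∂(stdGauss d) - ∫ x, h x * g (-x) ∂(stdGauss d) := by
      intro g hg hg1
      have i1 := integrable_mul_of_bound hi hg 1 hg1
      have i2 := integrable_comp_neg_stdGauss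
        (integrable_mul_of_bound hi (hg.comp measurable_neg) 1 fun x => hg1 _)
      have e2 := integral_comp_neg_stdGauss fun x => h x * g (-x)
      simp only [Function.comp_def, neg_neg] at i2 e2
      simp only [sub_mul]
      rw [integral_sub i1 i2, e2]
    have hodd := ae_eq_zero_of_integral_trig (k := fun x => h x - h (-x))
      (hm.sub (hm.comp measurable_neg)) (hi.sub (integrable_comp_neg_stdGauss hi))
      (fun ξ => by
        rw [hmul (fun x => Real.cos (ξ ⬝ᵥ x))
          (Real.continuous_cos.measurable.comp (measurable_dotProduct ξ))
          fun x => Real.abs_cos_le_one _]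
        simp)
      (fun ξ => by
        rw [hmul (fun x => Real.sin (ξ ⬝ᵥ x))
          (Real.continuous_sin.measurable.comp (measurable_dotProduct ξ))
          fun x => Real.abs_sin_le_one _]
        simp [hsin, integral_neg])
    have h0 := hmul f hf.measurable hf.abs_le_one
    have h1 : ∫ x, (h x - h (-x)) * f x ∂(stdGauss d) = 0 := by
      refine integral_eq_zero_of_ae ?_
      filter_upwards [hodd] with x hx
      simp only [Pi.zero_apply] at hx ⊢
      rw [hx, zero_mul]
    rw [h1] at h0
    simp only [hf.odd, mul_neg, integral_neg] at h0
    rw [L2.inner_def]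
    have h2 : ∫ x, h x * f x ∂(stdGauss d) = 0 := by linarith
    rw [← h2]
    refine integral_congr_ae ?_
    filter_upwards [mf.coeFn_toLp] with x hx
    simp [hx, mul_comm]
  obtain ⟨g, hg, hdist⟩ := Metric.mem_closure_iff.1 hmem ε hε
  obtain ⟨c, rfl⟩ := Finsupp.mem_span_range_iff_exists_finsupp.1 hg
  refine ⟨c.support, c, ?_⟩
  have mg : MemLp (fun x => f x - sineSum c.support c x) 2 (stdGauss d) :=
    mf.sub (memLp_bdd _ (continuous_sineSum _ _).measurable _ (abs_sineSum_le _ _))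
  have hcoe : (mf.toLp - c.sum fun ξ a => a • S ξ : Lp ℝ 2 (stdGauss d)) =ᵐ[stdGauss d]
      fun x => f x - sineSum c.support c x := by
    have h1 : (c.sum fun ξ a => a • S ξ : Lp ℝ 2 (stdGauss d)) =ᵐ[stdGauss d]
        fun x => sineSum c.support c x := by
      rw [Finsupp.sum]
      induction c.support using Finset.induction_on with
      | empty =>
        rw [Finset.sum_empty]
        filter_upwards [Lp.coeFn_zero ℝ 2 (stdGauss d)] with x hx
        rw [hx]
        simp [sineSum]
      | insert ξ t hξ ih =>
        rw [Finset.sum_insert hξ]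
        filter_upwards [Lp.coeFn_add (c ξ • S ξ) (∑ η ∈ t, c η • S η), ih,
          Lp.coeFn_smul (c ξ) (S ξ), (msin ξ).coeFn_toLp] with x h1 h2 h3 h4
        rw [h1, Pi.add_apply, h2, h3, Pi.smul_apply, h4, smul_eq_mul, sineSum, sineSum,
          Finset.sum_insert hξ]
    filter_upwards [Lp.coeFn_sub mf.toLp (c.sum fun ξ a => a • S ξ), mf.coeFn_toLp, h1]
      with x h2 h3 h4
    rw [h2, Pi.sub_apply, h3, h4]
  rw [dist_eq_norm] at hdist
  have e : ∫ x, (f x - sineSum c.support c x) ^ 2 ∂(stdGauss d) =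
      ‖(mf.toLp - c.sum fun ξ a => a • S ξ : Lp ℝ 2 (stdGauss d))‖ ^ 2 := by
    rw [← real_inner_self_eq_norm_sq, L2.inner_def]
    refine integral_congr_ae ?_
    filter_upwards [hcoe] with x hx
    rw [hx]
    simp [sq]
  rw [e]
  gcongr

end

section

variable {d : ℕ}

/-! ### The power series of the second moment function -/

theorem integrable_prod_mul {f g : (Fin d → ℝ) → ℝ} (hf : Measurable f) (hg : Measurable g)
    {A B : ℝ} (hA : ∀ x, |f x| ≤ A) (hB : ∀ x, |g x| ≤ B) (ρ : ℝ) :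
    Integrable (fun q : (Fin d → ℝ) × (Fin d → ℝ) =>
      f q.1 * g (ρ • q.1 + √(1 - ρ ^ 2) • q.2)) ((stdGauss d).prod (stdGauss d)) := by
  refine integrable_of_bound ((hf.comp measurable_fst).mul (hg.comp (measurable_mix ρ))) (A * B)
    fun q => ?_
  rw [abs_mul]
  exact mul_le_mul (hA _) (hB _) (abs_nonneg _) ((abs_nonneg _).trans (hA q.1))

/-- The Schur product theorem for odd powers of a Gram matrix, by expansion of the powers. -/
theorem sum_mul_dotProduct_pow_nonneg (s : Finset (Fin d → ℝ)) (w : (Fin d → ℝ) → ℝ) (k : ℕ) :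
    0 ≤ ∑ ξ ∈ s, ∑ η ∈ s, w ξ * w η * (ξ ⬝ᵥ η) ^ k := by
  have e : ∀ ξ η : Fin d → ℝ, w ξ * w η * (ξ ⬝ᵥ η) ^ k =
      ∑ p : Fin k → Fin d, (w ξ * ∏ j, ξ (p j)) * (w η * ∏ j, η (p j)) := fun ξ η => by
    rw [dotProduct, Fintype.sum_pow, Finset.mul_sum]
    refine Finset.sum_congr rfl fun p _ => ?_
    rw [Finset.prod_mul_distrib]
    ring
  simp only [e]
  have e2 : ∑ ξ ∈ s, ∑ η ∈ s, ∑ p : Fin k → Fin d,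
      (w ξ * ∏ j, ξ (p j)) * (w η * ∏ j, η (p j)) =
      ∑ p : Fin k → Fin d, (∑ ξ ∈ s, w ξ * ∏ j, ξ (p j)) * ∑ η ∈ s, w η * ∏ j, η (p j) := by
    simp only [Finset.sum_mul_sum]
    rw [Finset.sum_comm]
    rw [Finset.sum_comm (s := s) (t := s)]
    rw [Finset.sum_comm (s := Finset.univ)]
    refine Finset.sum_congr rfl fun ξ _ => ?_
    rw [Finset.sum_comm]
  rw [e2]
  exact Finset.sum_nonneg fun p _ => mul_self_nonneg _

/-- The coefficients of the second moment function of a combination of sines. -/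
def sineCoeff (s : Finset (Fin d → ℝ)) (c : (Fin d → ℝ) → ℝ) (n : ℕ) : ℝ :=
  (∑ ξ ∈ s, ∑ η ∈ s, (c ξ * Real.exp (-(ξ ⬝ᵥ ξ) / 2)) * (c η * Real.exp (-(η ⬝ᵥ η) / 2)) *
    (ξ ⬝ᵥ η) ^ (2 * n + 1)) / (2 * n + 1).factorial

theorem isOddSeries_sineSum (s : Finset (Fin d → ℝ)) (c : (Fin d → ℝ) → ℝ) :
    IsOddSeries (F₂ (sineSum s c)) (sineCoeff s c) := by
  refine ⟨fun n => div_nonneg (sum_mul_dotProduct_pow_nonneg s _ _) (by positivity),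
    fun ρ hρ => ?_⟩
  have hsin : ∀ ξ : Fin d → ℝ, Measurable fun x : Fin d → ℝ => Real.sin (ξ ⬝ᵥ x) := fun ξ =>
    Real.continuous_sin.measurable.comp (measurable_dotProduct ξ)
  have hF : F₂ (sineSum s c) ρ = ∑ ξ ∈ s, ∑ η ∈ s, c ξ * c η *
      (Real.exp (-(ξ ⬝ᵥ ξ) / 2) * Real.exp (-(η ⬝ᵥ η) / 2) * Real.sinh (ρ * (ξ ⬝ᵥ η))) := by
    have e : ∀ q : (Fin d → ℝ) × (Fin d → ℝ),
        sineSum s c q.1 * sineSum s c (ρ • q.1 + √(1 - ρ ^ 2) • q.2) =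
        ∑ ξ ∈ s, ∑ η ∈ s, c ξ * c η *
          (Real.sin (ξ ⬝ᵥ q.1) * Real.sin (η ⬝ᵥ (ρ • q.1 + √(1 - ρ ^ 2) • q.2))) := fun q => by
      rw [sineSum, sineSum, Finset.sum_mul_sum]
      refine Finset.sum_congr rfl fun ξ _ => Finset.sum_congr rfl fun η _ => by ring
    have hi : ∀ ξ η : Fin d → ℝ, Integrable (fun q : (Fin d → ℝ) × (Fin d → ℝ) => c ξ * c η *
        (Real.sin (ξ ⬝ᵥ q.1) * Real.sin (η ⬝ᵥ (ρ • q.1 + √(1 - ρ ^ 2) • q.2))))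
        ((stdGauss d).prod (stdGauss d)) := fun ξ η =>
      (integrable_prod_mul (hsin ξ) (hsin η) (fun _ => Real.abs_sin_le_one _)
        (fun _ => Real.abs_sin_le_one _) ρ).const_mul _
    simp only [F₂, e]
    rw [integral_finsetSum _ fun ξ _ => integrable_finsetSum _ fun η _ => hi ξ η]
    refine Finset.sum_congr rfl fun ξ _ => ?_
    rw [integral_finsetSum _ fun η _ => hi ξ η]
    refine Finset.sum_congr rfl fun η _ => ?_
    rw [integral_const_mul, integral_sin_mul_sin hρ]
  rw [hF]
  have hs : HasSum (fun n => ∑ ξ ∈ s, ∑ η ∈ s, c ξ * c η * (Real.exp (-(ξ ⬝ᵥ ξ) / 2) *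
      Real.exp (-(η ⬝ᵥ η) / 2) * ((ρ * (ξ ⬝ᵥ η)) ^ (2 * n + 1) / (2 * n + 1).factorial)))
      (∑ ξ ∈ s, ∑ η ∈ s, c ξ * c η *
      (Real.exp (-(ξ ⬝ᵥ ξ) / 2) * Real.exp (-(η ⬝ᵥ η) / 2) * Real.sinh (ρ * (ξ ⬝ᵥ η)))) :=
    hasSum_sum fun ξ _ => hasSum_sum fun η _ => ((Real.hasSum_sinh _).mul_left _).mul_left _
  convert hs using 2 with n
  rw [sineCoeff, oddPow, Finset.sum_div, Finset.sum_mul]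
  refine Finset.sum_congr rfl fun ξ _ => ?_
  rw [Finset.sum_div, Finset.sum_mul]
  refine Finset.sum_congr rfl fun η _ => ?_
  rw [mul_pow]
  ring

/-- The first coefficient is the squared length of the vector of first moments. -/
theorem sineCoeff_zero (s : Finset (Fin d → ℝ)) (c : (Fin d → ℝ) → ℝ) :
    sineCoeff s c 0 = ∑ i, (∫ x, x i * sineSum s c x ∂(stdGauss d)) ^ 2 := by
  have e : ∀ i, ∫ x, x i * sineSum s c x ∂(stdGauss d) =
      ∑ ξ ∈ s, c ξ * Real.exp (-(ξ ⬝ᵥ ξ) / 2) * ξ i := fun i => by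
    have h1 : ∀ x : Fin d → ℝ, x i * sineSum s c x =
        ∑ ξ ∈ s, c ξ * ((Pi.single i 1 ⬝ᵥ x) * Real.sin (ξ ⬝ᵥ x)) := fun x => by
      rw [single_one_dotProduct, sineSum, Finset.mul_sum]
      exact Finset.sum_congr rfl fun ξ _ => by ring
    simp only [h1]
    have hi : ∀ ξ ∈ s, Integrable (fun x : Fin d → ℝ =>
        c ξ * ((Pi.single i 1 ⬝ᵥ x) * Real.sin (ξ ⬝ᵥ x))) (stdGauss d) := fun ξ _ =>
      (integrable_mul_of_bound (integrable_dotProduct _)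
        (Real.continuous_sin.measurable.comp (measurable_dotProduct ξ)) 1
        fun x => Real.abs_sin_le_one _).const_mul _
    rw [integral_finsetSum _ hi]
    refine Finset.sum_congr rfl fun ξ _ => ?_
    rw [integral_const_mul, integral_dotProduct_mul_sin, single_one_dotProduct, mul_assoc]
  simp only [e, sineCoeff, sq, Finset.sum_mul_sum]
  simp only [mul_zero, zero_add, pow_one, Nat.factorial_one, Nat.cast_one, div_one]
  rw [Finset.sum_comm (s := Finset.univ)]
  refine Finset.sum_congr rfl fun ξ _ => ?_
  rw [Finset.sum_comm]
  refine Finset.sum_congr rfl fun η _ => ?_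
  rw [show ξ ⬝ᵥ η = ∑ i, ξ i * η i from rfl, Finset.mul_sum]
  exact Finset.sum_congr rfl fun i _ => by ring

/-- A uniform limit on `[-1, 1]` of odd power series with nonnegative coefficients is one
as well, with coefficients that are limits along a subsequence. -/
theorem exists_isOddSeries_of_tendsto {F : ℝ → ℝ} {G : ℕ → ℝ → ℝ} {a : ℕ → ℕ → ℝ}
    (hG : ∀ m, IsOddSeries (G m) (a m))
    (hlim : TendstoUniformlyOn G F Filter.atTop (Set.Icc (-1) 1)) :
    ∃ b : ℕ → ℝ, ∃ φ : ℕ → ℕ, StrictMono φ ∧ IsOddSeries F b ∧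
      ∀ n, Filter.Tendsto (fun m => a (φ m) n) Filter.atTop (nhds (b n)) := by
  have h1mem : (1 : ℝ) ∈ Set.Icc (-1 : ℝ) 1 := ⟨by norm_num, le_rfl⟩
  have hsum1 : ∀ m, HasSum (a m) (G m 1) := fun m => by
    simpa [oddPow] using (hG m).hasSum 1 h1mem
  obtain ⟨M, hM⟩ : ∃ M, ∀ m, G m 1 ≤ M := by
    obtain ⟨M, hM⟩ := (hlim.tendsto_at h1mem).bddAbove_range
    exact ⟨M, fun m => hM ⟨m, rfl⟩⟩
  have haM : ∀ m n, a m n ∈ Set.Icc (0 : ℝ) M := fun m n =>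
    ⟨(hG m).nonneg n, (le_hasSum (hsum1 m) n fun k _ => (hG m).nonneg k).trans (hM m)⟩
  obtain ⟨b, hb, φ, hφ, hconv⟩ := (isCompact_univ_pi fun _ : ℕ => isCompact_Icc (a := (0 : ℝ))
    (b := M)).tendsto_subseq (x := a) fun m n _ => haM m n
  rw [tendsto_pi_nhds] at hconv
  have hb0 : ∀ n, 0 ≤ b n := fun n => (hb n trivial).1
  have hbsum : Summable b := by
    refine summable_of_sum_le (c := M) hb0 fun u => ?_
    refine le_of_tendsto (tendsto_finsetSum u fun n _ => hconv n)
      (Filter.Eventually.of_forall fun m => ?_)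
    exact (sum_le_hasSum u (fun k _ => (hG (φ m)).nonneg k) (hsum1 (φ m))).trans (hM _)
  have hbound : ∀ n, ∀ x ∈ Set.Icc (-1 : ℝ) 1, ‖b n * oddPow n x‖ ≤ b n := fun n x hx => by
    rw [norm_mul, Real.norm_of_nonneg (hb0 n)]
    exact mul_le_of_le_one_right (hb0 n) (abs_oddPow_le_one n hx)
  have hopen : ∀ x ∈ Set.Ioo (-1 : ℝ) 1, F x = ∑' n, b n * oddPow n x := by
    intro x hx
    have hx' : x ∈ Set.Icc (-1 : ℝ) 1 := Set.Ioo_subset_Icc_self hx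
    have hsx : Summable fun n => M * |oddPow n x| := by
      have h2 : x ^ 2 < 1 := (sq_lt_one_iff_abs_lt_one x).2 (abs_lt.2 hx)
      have := ((summable_geometric_of_lt_one (sq_nonneg x) h2).mul_left |x|).mul_left M
      refine this.congr fun n => ?_
      rw [oddPow, pow_succ x (2 * n), pow_mul, abs_mul,
        abs_of_nonneg (pow_nonneg (sq_nonneg x) n), mul_comm |x|]
    have ht := tendsto_tsum_of_dominated_convergence (𝓕 := Filter.atTop)
      (f := fun m n => a (φ m) n * oddPow n x) (g := fun n => b n * oddPow n x) hsx
      (fun n => (hconv n).mul_const _) (Filter.Eventually.of_forall fun m n => by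
        rw [norm_mul, Real.norm_of_nonneg ((hG (φ m)).nonneg n)]
        exact mul_le_mul_of_nonneg_right (haM _ _).2 (abs_nonneg _))
    simp only [((hG _).hasSum x hx').tsum_eq] at ht
    exact tendsto_nhds_unique ((hlim.tendsto_at hx').comp hφ.tendsto_atTop) ht
  have hcF : ContinuousOn F (Set.Icc (-1) 1) :=
    hlim.continuousOn (Filter.Frequently.of_forall fun m => (hG m).continuousOn)
  have hcS : ContinuousOn (fun x => ∑' n, b n * oddPow n x) (Set.Icc (-1) 1) :=
    continuousOn_tsum (fun n => ((continuous_oddPow n).const_mul _).continuousOn) hbsum hbound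
  have hall : Set.EqOn F (fun x => ∑' n, b n * oddPow n x) (Set.Icc (-1) 1) :=
    Set.EqOn.of_subset_closure hopen hcF hcS Set.Ioo_subset_Icc_self
      (closure_Ioo (by norm_num : (-1 : ℝ) ≠ 1)).ge
  refine ⟨b, φ, hφ, ⟨hb0, fun x hx => ?_⟩, hconv⟩
  rw [hall hx]
  exact (Summable.of_norm_bounded hbsum fun n => hbound n x hx).hasSum

/-- The second moment functions of functions close in `L²` are close. -/
theorem abs_F₂_sub_le {f g : (Fin d → ℝ) → ℝ} (hf : Measurable f) (hf1 : ∀ x, |f x| ≤ 1)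
    (hg : Measurable g) {C : ℝ} (hgC : ∀ x, |g x| ≤ C) {ε : ℝ} (hε : 0 < ε) (hε1 : ε ≤ 1)
    (hfg : ∫ x, (f x - g x) ^ 2 ∂(stdGauss d) ≤ ε ^ 2) {ρ : ℝ} (hρ : ρ ∈ Set.Icc (-1 : ℝ) 1) :
    |F₂ f ρ - F₂ g ρ| ≤ 3 * ε := by
  set γ := stdGauss d
  let k : (Fin d → ℝ) → ℝ := fun x => f x - g x
  have hk : Measurable k := hf.sub hg
  have hkC : ∀ x, |k x| ≤ 1 + C := fun x => (abs_sub _ _).trans (add_le_add (hf1 x) (hgC x))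
  let V : (Fin d → ℝ) × (Fin d → ℝ) → (Fin d → ℝ) := fun q => ρ • q.1 + √(1 - ρ ^ 2) • q.2
  have hV : MeasurePreserving V (γ.prod γ) γ := measurePreserving_mix hρ
  -- Pointwise, `|k| ≤ ε / 2 + k² / (2 ε)`, so everything is controlled by `k²`.
  let K : (Fin d → ℝ) → ℝ := fun x => ε / 2 + (1 / (2 * ε) + 1 / 2) * k x ^ 2
  have hkK : ∀ x, |k x| + k x ^ 2 / 2 ≤ K x := fun x => by
    have h1 : |k x| ≤ ε / 2 + 1 / (2 * ε) * k x ^ 2 := by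
      have h2 : ε * |k x| ≤ ε * (ε / 2 + 1 / (2 * ε) * k x ^ 2) := by
        have h3 : ε * (ε / 2 + 1 / (2 * ε) * k x ^ 2) = ε ^ 2 / 2 + k x ^ 2 / 2 := by
          field_simp
        rw [h3]
        nlinarith [sq_nonneg (ε - |k x|), sq_abs (k x)]
      exact le_of_mul_le_mul_left h2 hε
    simp only [K]
    linarith
  have hk2 : Integrable (fun x => k x ^ 2) γ := integrable_of_bound (hk.pow_const 2)
    ((1 + C) ^ 2) fun x => by rw [abs_pow]; exact pow_le_pow_left₀ (abs_nonneg _) (hkC x) 2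
  have hKi : Integrable K γ := (integrable_const _).add (hk2.const_mul _)
  have hKint : ∫ x, K x ∂γ ≤ 3 / 2 * ε := by
    have e : ∫ x, K x ∂γ = ε / 2 + (1 / (2 * ε) + 1 / 2) * ∫ x, k x ^ 2 ∂γ := by
      simp only [K]
      rw [integral_add (integrable_const _) (hk2.const_mul _), integral_const_mul]
      simp
    rw [e]
    have h1 : (1 / (2 * ε) + 1 / 2) * ∫ x, k x ^ 2 ∂γ ≤ (1 / (2 * ε) + 1 / 2) * ε ^ 2 :=
      mul_le_mul_of_nonneg_left hfg (by positivity)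
    have h2 : (1 / (2 * ε) + 1 / 2) * ε ^ 2 = ε / 2 + ε ^ 2 / 2 := by field_simp
    nlinarith
  have i1 : Integrable (fun q : (Fin d → ℝ) × (Fin d → ℝ) => K q.1) (γ.prod γ) :=
    measurePreserving_fst.integrable_comp_of_integrable hKi
  have i2 : Integrable (fun q => K (V q)) (γ.prod γ) := hV.integrable_comp_of_integrable hKi
  have hKm : AEStronglyMeasurable K γ := hKi.aestronglyMeasurable
  have e1 : ∫ q : (Fin d → ℝ) × (Fin d → ℝ), K q.1 ∂(γ.prod γ) = ∫ x, K x ∂γ := by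
    conv_rhs => rw [← (measurePreserving_fst (μ := γ) (ν := γ)).map_eq]
    rw [integral_map measurable_fst.aemeasurable (by rwa [measurePreserving_fst.map_eq])]
  have e2 : ∫ q, K (V q) ∂(γ.prod γ) = ∫ x, K x ∂γ := by
    conv_rhs => rw [← hV.map_eq]
    rw [integral_map hV.measurable.aemeasurable (by rwa [hV.map_eq])]
  have hdiff : F₂ f ρ - F₂ g ρ =
      ∫ q, (f q.1 * f (V q) - g q.1 * g (V q)) ∂(γ.prod γ) :=
    (integral_sub (integrable_prod_mul hf hf hf1 hf1 ρ) (integrable_prod_mul hg hg hgC hgC ρ)).symm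
  rw [hdiff]
  calc |∫ q, (f q.1 * f (V q) - g q.1 * g (V q)) ∂(γ.prod γ)|
      ≤ ∫ q, (K q.1 + K (V q)) ∂(γ.prod γ) := by
        rw [← Real.norm_eq_abs]
        refine norm_integral_le_of_norm_le (i1.add i2) (Filter.Eventually.of_forall fun q => ?_)
        have hg' : ∀ x, g x = f x - k x := fun x => by simp [k]
        rw [hg', hg', Real.norm_eq_abs, show f q.1 * f (V q) - (f q.1 - k q.1) * (f (V q) - k (V q))
          = f q.1 * k (V q) + k q.1 * f (V q) + -(k q.1 * k (V q)) by ring]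
        refine (abs_add_three _ _ _).trans ?_
        rw [abs_neg, abs_mul, abs_mul, abs_mul]
        have t1 := mul_le_of_le_one_left (abs_nonneg (k (V q))) (hf1 q.1)
        have t2 := mul_le_of_le_one_right (abs_nonneg (k q.1)) (hf1 (V q))
        have t3 := two_mul_le_add_sq |k q.1| |k (V q)|
        rw [sq_abs, sq_abs] at t3
        linarith [hkK q.1, hkK (V q)]
    _ = ∫ x, K x ∂γ + ∫ x, K x ∂γ := by rw [integral_add i1 i2, e1, e2]
    _ ≤ 3 * ε := by linarith

/-- The first moments of functions close in `L²` are close. -/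
theorem abs_integral_coord_mul_sub_le {f g : (Fin d → ℝ) → ℝ} (hf : Measurable f)
    (hf1 : ∀ x, |f x| ≤ 1) (hg : Measurable g) {C : ℝ} (hgC : ∀ x, |g x| ≤ C) {ε : ℝ} (hε : 0 < ε)
    (hfg : ∫ x, (f x - g x) ^ 2 ∂(stdGauss d) ≤ ε ^ 2) (i : Fin d) :
    |∫ x, x i * f x ∂(stdGauss d) - ∫ x, x i * g x ∂(stdGauss d)| ≤ ε := by
  have hx2 := integrable_dotProduct_sq (Pi.single i 1 : Fin d → ℝ)
  have hx1 := integrable_dotProduct (Pi.single i 1 : Fin d → ℝ)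
  simp only [single_one_dotProduct, Pi.single_eq_same] at hx1 hx2
  have hk2 : Integrable (fun x => (f x - g x) ^ 2) (stdGauss d) :=
    integrable_of_bound ((hf.sub hg).pow_const 2) ((1 + C) ^ 2) fun x => by
      rw [abs_pow]
      exact pow_le_pow_left₀ (abs_nonneg _) ((abs_sub _ _).trans (add_le_add (hf1 x) (hgC x))) 2
  rw [← integral_sub (integrable_mul_of_bound hx1 hf 1 hf1) (integrable_mul_of_bound hx1 hg C hgC)]
  calc |∫ x, (x i * f x - x i * g x) ∂(stdGauss d)|
      ≤ ∫ x, (ε / 2 * x i ^ 2 + 1 / (2 * ε) * (f x - g x) ^ 2) ∂(stdGauss d) := by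
        rw [← Real.norm_eq_abs]
        refine norm_integral_le_of_norm_le ((hx2.1.const_mul _).add (hk2.const_mul _))
          (Filter.Eventually.of_forall fun x => ?_)
        rw [Real.norm_eq_abs, ← mul_sub, abs_mul]
        refine le_of_mul_le_mul_left ?_ hε
        have h3 : ε * (ε / 2 * x i ^ 2 + 1 / (2 * ε) * (f x - g x) ^ 2) =
            (ε * x i) ^ 2 / 2 + (f x - g x) ^ 2 / 2 := by field_simp
        rw [h3]
        have t := two_mul_le_add_sq |ε * x i| |f x - g x|
        rw [sq_abs, sq_abs, abs_mul, abs_of_pos hε] at t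
        linarith
    _ = ε / 2 + 1 / (2 * ε) * ∫ x, (f x - g x) ^ 2 ∂(stdGauss d) := by
        rw [integral_add (hx2.1.const_mul _) (hk2.const_mul _), integral_const_mul,
          integral_const_mul, hx2.2, mul_one]
    _ ≤ ε / 2 + 1 / (2 * ε) * ε ^ 2 := by gcongr
    _ = ε := by field_simp; ring

/-- The second moment function of a rounding function is an odd power series with nonnegative
coefficients, and its linear coefficient is the squared length of the vector of first moments. -/
theorem IsRounding.exists_isOddSeries {f : (Fin d → ℝ) → ℝ} (hf : IsRounding f) :
    ∃ a, IsOddSeries (F₂ f) a ∧ a 0 = ∑ i, (∫ x, x i * f x ∂(stdGauss d)) ^ 2 := by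
  let ε : ℕ → ℝ := fun m => 1 / ((m : ℝ) + 1)
  have hε : ∀ m, 0 < ε m := fun m => Nat.one_div_pos_of_nat
  have hε1 : ∀ m, ε m ≤ 1 := fun m => by
    rw [div_le_one (by positivity)]
    linarith [(Nat.cast_nonneg m : (0 : ℝ) ≤ m)]
  have hεlim : Filter.Tendsto ε Filter.atTop (nhds 0) := tendsto_one_div_add_atTop_nhds_zero_nat
  choose s c hsc using fun m => hf.exists_sineSum (hε m)
  have hm : ∀ m, Measurable (sineSum (s m) (c m)) := fun m => (continuous_sineSum _ _).measurable
  have hlim : TendstoUniformlyOn (fun m => F₂ (sineSum (s m) (c m))) (F₂ f) Filter.atTop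
      (Set.Icc (-1) 1) := by
    rw [Metric.tendstoUniformlyOn_iff]
    intro δ hδ
    have h3 : Filter.Tendsto (fun m => 3 * ε m) Filter.atTop (nhds 0) := by
      simpa using hεlim.const_mul 3
    filter_upwards [h3.eventually_lt_const hδ] with m hm' x hx
    exact (abs_F₂_sub_le hf.measurable hf.abs_le_one (hm m) (abs_sineSum_le _ _) (hε m) (hε1 m)
      (hsc m) hx).trans_lt hm'
  obtain ⟨a, φ, hφ, ha, hconv⟩ :=
    exists_isOddSeries_of_tendsto (fun m => isOddSeries_sineSum (s m) (c m)) hlim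
  refine ⟨a, ha, tendsto_nhds_unique (hconv 0) ?_⟩
  simp only [sineCoeff_zero]
  refine tendsto_finsetSum _ fun i _ => Filter.Tendsto.pow ?_ 2
  refine Filter.Tendsto.comp (g := fun m => ∫ x, x i * sineSum (s m) (c m) x ∂(stdGauss d)) ?_
    hφ.tendsto_atTop
  rw [tendsto_iff_dist_tendsto_zero]
  refine squeeze_zero (fun _ => dist_nonneg) (fun m => ?_) hεlim
  rw [dist_comm]
  exact abs_integral_coord_mul_sub_le hf.measurable hf.abs_le_one (hm m) (abs_sineSum_le _ _)
    (hε m) (hsc m) i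

theorem F₂_one (f : (Fin d → ℝ) → ℝ) : F₂ f 1 = ∫ x, f x ^ 2 ∂(stdGauss d) := by
  have := integral_prod_mul (μ := stdGauss d) (ν := stdGauss d) (fun x => f x ^ 2) fun _ => (1 : ℝ)
  simp only [mul_one, integral_const, probReal_univ, smul_eq_mul] at this
  rw [← this, F₂]
  simp [sq]

/-- The second moment function of a rounding function is nonlinear: otherwise `f` would agree
with `v ⬝ x`, `v` its vector of first moments, and that is unbounded unless `v = 0`. -/
theorem IsRounding.exists_coeff_ne_zero {f : (Fin d → ℝ) → ℝ} (hf : IsRounding f)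
    (hne : ¬ f =ᵐ[stdGauss d] 0) {a : ℕ → ℝ} (ha : IsOddSeries (F₂ f) a)
    (ha0 : a 0 = ∑ i, (∫ x, x i * f x ∂(stdGauss d)) ^ 2) : ∃ N, 1 ≤ N ∧ a N ≠ 0 := by
  by_contra! hcon
  refine hne ?_
  have hF1 : F₂ f 1 = a 0 := by
    have h1 := ha.hasSum 1 ⟨by norm_num, le_rfl⟩
    simp only [oddPow, one_pow, mul_one] at h1
    exact h1.unique (hasSum_single 0 fun n hn => hcon n (Nat.one_le_iff_ne_zero.2 hn))
  set v : Fin d → ℝ := fun i => ∫ x, x i * f x ∂(stdGauss d) with hv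
  have hvv : a 0 = v ⬝ᵥ v := by rw [ha0]; simp [dotProduct, v, sq]
  have hx1 : ∀ i, Integrable (fun x : Fin d → ℝ => x i) (stdGauss d) := fun i => by
    simpa using integrable_dotProduct (Pi.single i 1 : Fin d → ℝ)
  have hvf : ∫ x, (v ⬝ᵥ x) * f x ∂(stdGauss d) = v ⬝ᵥ v := by
    have e : ∀ x, (v ⬝ᵥ x) * f x = ∑ i, v i * (x i * f x) := fun x => by
      rw [dotProduct, Finset.sum_mul]
      exact Finset.sum_congr rfl fun i _ => by ring
    simp only [e]
    rw [integral_finsetSum _ fun i _ =>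
      (integrable_mul_of_bound (hx1 i) hf.measurable 1 hf.abs_le_one).const_mul _]
    simp only [integral_const_mul]
    rfl
  have if2 : Integrable (fun x => f x ^ 2) (stdGauss d) :=
    integrable_of_bound (hf.measurable.pow_const 2) (1 ^ 2) fun x => by
      rw [abs_pow]; exact pow_le_pow_left₀ (abs_nonneg _) (hf.abs_le_one x) 2
  have ivf : Integrable (fun x => 2 * ((v ⬝ᵥ x) * f x)) (stdGauss d) :=
    (integrable_mul_of_bound (integrable_dotProduct v) hf.measurable 1 hf.abs_le_one).const_mul _
  obtain ⟨iv2, ev2⟩ := integrable_dotProduct_sq v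
  have hzero : ∫ x, (f x - v ⬝ᵥ x) ^ 2 ∂(stdGauss d) = 0 := by
    have e : ∀ x, (f x - v ⬝ᵥ x) ^ 2 = f x ^ 2 - 2 * ((v ⬝ᵥ x) * f x) + (v ⬝ᵥ x) ^ 2 :=
      fun x => by ring
    simp only [e]
    have isub : Integrable (fun x => f x ^ 2 - 2 * ((v ⬝ᵥ x) * f x)) (stdGauss d) := if2.sub ivf
    rw [integral_add isub iv2, integral_sub if2 ivf, integral_const_mul, hvf, ev2,
      ← F₂_one, hF1, hvv]
    ring
  have hi : Integrable (fun x => (f x - v ⬝ᵥ x) ^ 2) (stdGauss d) := by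
    refine ((if2.sub ivf).add iv2).congr (Filter.Eventually.of_forall fun x => ?_)
    simp only [Pi.add_apply, Pi.sub_apply]
    ring
  have hfv : ∀ᵐ x ∂(stdGauss d), f x = v ⬝ᵥ x := by
    have := (integral_eq_zero_iff_of_nonneg (fun x => sq_nonneg _) hi).1 hzero
    filter_upwards [this] with x hx
    exact sub_eq_zero.1 (pow_eq_zero_iff (two_ne_zero)|>.1 hx)
  have hvv0 : v ⬝ᵥ v = 0 := by
    by_contra hpos
    have hpos' : 0 < v ⬝ᵥ v :=
      lt_of_le_of_ne (Finset.sum_nonneg fun _ _ => mul_self_nonneg _) (Ne.symm hpos)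
    have hg : gaussianReal 0 (v ⬝ᵥ v).toNNReal (Set.Ioi 1) = 0 := by
      rw [← map_dotProduct, Measure.map_apply (measurable_dotProduct v) measurableSet_Ioi]
      refine measure_mono_null ?_ (ae_iff.1 hfv)
      intro x hx hfx
      have h1 : 1 < v ⬝ᵥ x := hx
      linarith [(hf.mem_Icc x).2]
    have := gaussianReal_absolutelyContinuous' 0 (Real.toNNReal_pos.2 hpos').ne' hg
    simp at this
  filter_upwards [hfv] with x hx
  rw [hx, dotProduct_self_eq_zero.1 hvv0]
  simp

end

/-! ### Existence and uniqueness of hardest distributions -/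

theorem s₃_eq {d : ℕ} (f : (Fin d → ℝ) → ℝ) (D : Measure (ℝ × ℝ × ℝ)) :
    s₃ f D = (3 - ∫ b, tripleSum (F₂ f) b ∂D) / 4 := rfl

theorem continuousOn_tripleSum {F : ℝ → ℝ} (hF : ContinuousOn F (Set.Icc (-1) 1)) :
    ContinuousOn (tripleSum F) biasTriples := by
  unfold tripleSum
  refine ((hF.comp (by fun_prop) fun b hb => (mem_Icc_of_mem_biasTriples hb).1).add
    (hF.comp (by fun_prop) fun b hb => (mem_Icc_of_mem_biasTriples hb).2.1)).add
    (hF.comp (by fun_prop) fun b hb => (mem_Icc_of_mem_biasTriples hb).2.2)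

theorem exists_hasCompleteness {c : ℝ} (hc : c ∈ Set.Icc (0 : ℝ) 1) :
    ∃ D, HasCompleteness D c := by
  have hw : 1 - c ∈ Set.Icc (0 : ℝ) 1 := ⟨by linarith [hc.2], by linarith [hc.1]⟩
  refine ⟨_, (hasCompleteness_twoPoint_iff hw (p := ((-1, -1, 1), (1, 1, 1)))
    (Or.inr ⟨1, ⟨by norm_num, le_rfl⟩, rfl⟩)).2 ?_⟩
  simp only [tripleSum, id]
  ring

/-- Domination in the form of inequalities between integrals. -/
theorem exists_dominating_integral {D : Measure (ℝ × ℝ × ℝ)} {c : ℝ} (hD : HasCompleteness D c) :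
    ∃ w ∈ Set.Icc (0 : ℝ) 1, ∃ p ∈ hardPairs, HasCompleteness (twoPoint w p.1 p.2) c ∧
      ∀ h s, OddConvex h s →
        ∫ b, tripleSum h b ∂D ≤ ∫ b, tripleSum h b ∂(twoPoint w p.1 p.2) := by
  obtain ⟨w, hw, p, hp, hcomp, hdom⟩ := exists_dominating hD
  refine ⟨w, hw, p, hp, hcomp, fun h s H => ?_⟩
  rw [integral_twoPoint hw]
  exact hdom h s H

theorem exists_hardForm_le {D : Measure (ℝ × ℝ × ℝ)} {c : ℝ} (hD : HasCompleteness D c) :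
    ∃ w ∈ Set.Icc (0 : ℝ) 1, ∃ p ∈ hardPairs, HasCompleteness (twoPoint w p.1 p.2) c ∧
      ∀ (d : ℕ) (f : (Fin d → ℝ) → ℝ), IsRounding f → s₃ f (twoPoint w p.1 p.2) ≤ s₃ f D := by
  obtain ⟨w, hw, p, hp, hcomp, hdom⟩ := exists_dominating_integral hD
  refine ⟨w, hw, p, hp, hcomp, fun d f hf => ?_⟩
  obtain ⟨a, ha, -⟩ := hf.exists_isOddSeries
  have := ha.integral_le_of_dominated hD.1 hcomp.1 hdom
  rw [s₃_eq, s₃_eq]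
  linarith

/-- The two-point distributions of hard form with completeness `c` are parametrized by
a compact set on which the performance of `f` is continuous. -/
theorem exists_isHardest {c : ℝ} (hc : c ∈ Set.Icc (0 : ℝ) 1) {d : ℕ} {f : (Fin d → ℝ) → ℝ}
    (hf : IsRounding f) : ∃ D, IsHardForm D ∧ IsHardest f c D := by
  obtain ⟨a, ha, -⟩ := hf.exists_isOddSeries
  let val : (ℝ → ℝ) → ℝ × ((ℝ × ℝ × ℝ) × (ℝ × ℝ × ℝ)) → ℝ := fun F q =>
    (1 - q.1) * tripleSum F q.2.1 + q.1 * tripleSum F q.2.2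
  let T : Set (ℝ × ((ℝ × ℝ × ℝ) × (ℝ × ℝ × ℝ))) :=
    (Set.Icc (0 : ℝ) 1 ×ˢ hardPairs) ∩ val id ⁻¹' {3 - 4 * c}
  have hT : IsCompact T := (isCompact_Icc.prod isCompact_hardPairs).inter_right
    (isClosed_singleton.preimage (by simp only [val, tripleSum, id]; fun_prop))
  have hcont : ContinuousOn (val (F₂ f)) T := by
    have h0 := continuousOn_tripleSum ha.continuousOn
    exact ((continuousOn_const.sub continuousOn_fst).mul (h0.comp (by fun_prop) fun q hq =>
      (mem_biasTriples_of_mem_hardPairs hq.1.2).1)).add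
      (continuousOn_fst.mul (h0.comp (by fun_prop) fun q hq =>
        (mem_biasTriples_of_mem_hardPairs hq.1.2).2))
  have memT : ∀ {w p}, w ∈ Set.Icc (0 : ℝ) 1 → p ∈ hardPairs →
      HasCompleteness (twoPoint w p.1 p.2) c → (w, p) ∈ T := fun hw hp h =>
    ⟨⟨hw, hp⟩, (hasCompleteness_twoPoint_iff hw hp).1 h⟩
  have hne : T.Nonempty := by
    obtain ⟨D, hD⟩ := exists_hasCompleteness hc
    obtain ⟨w, hw, p, hp, hcomp, -⟩ := exists_hardForm_le hD
    exact ⟨_, memT hw hp hcomp⟩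
  obtain ⟨⟨w, p⟩, ⟨⟨hw, hp⟩, hval⟩, hmax⟩ := hT.exists_isMaxOn hne hcont
  refine ⟨twoPoint w p.1 p.2, isHardForm_twoPoint w hp,
    (hasCompleteness_twoPoint_iff hw hp).2 hval, fun D' hD' => ?_⟩
  obtain ⟨w', hw', p', hp', hcomp', hle⟩ := exists_hardForm_le hD'
  refine le_trans ?_ (hle d f hf)
  have : val (F₂ f) (w', p') ≤ val (F₂ f) (w, p) := hmax (memT hw' hp' hcomp')
  rw [s₃_eq, s₃_eq, integral_twoPoint hw, integral_twoPoint hw']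
  simp only [val] at this
  linarith

/-- A hardest distribution for a nonzero rounding function performs like the distribution of
hard form that dominates it: the two have the same odd moments. -/
theorem IsHardest.exists_equivalent {c : ℝ} {d : ℕ} {f : (Fin d → ℝ) → ℝ} (hf : IsRounding f)
    (hne : ¬ f =ᵐ[stdGauss d] 0) {D : Measure (ℝ × ℝ × ℝ)} (hD : IsHardest f c D) :
    ∃ D', IsHardForm D' ∧ HasCompleteness D' c ∧
      ∀ (d' : ℕ) (g : (Fin d' → ℝ) → ℝ), IsRounding g → s₃ g D' = s₃ g D := by
  obtain ⟨w, hw, p, hp, hcomp, hdom⟩ := exists_dominating_integral hD.1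
  refine ⟨_, isHardForm_twoPoint w hp, hcomp, fun d' g hg => ?_⟩
  obtain ⟨a, ha, ha0⟩ := hf.exists_isOddSeries
  obtain ⟨N, hN, haN⟩ := hf.exists_coeff_ne_zero hne ha ha0
  have hle := hD.2 _ hcomp
  rw [s₃_eq, s₃_eq] at hle
  have heq := le_antisymm (ha.integral_le_of_dominated hD.1.1 hcomp.1 hdom) (by linarith)
  have hmom := ha.moment_eq_of_dominated hD.1.1 hcomp.1 hdom hN haN heq
  obtain ⟨a', ha', -⟩ := hg.exists_isOddSeries
  have h1 := ha'.hasSum_integral hD.1.1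
  simp only [hmom] at h1
  rw [s₃_eq, s₃_eq, h1.unique (ha'.hasSum_integral hcomp.1)]

end NAE3

end

theorem mainTheorem3 (c : ℝ) (hc : c ∈ Set.Icc (0 : ℝ) 1) :
    (∀ D : MeasureTheory.Measure (ℝ × ℝ × ℝ), NAE3.HasCompleteness D c →
      ∃ D' : MeasureTheory.Measure (ℝ × ℝ × ℝ), NAE3.IsHardForm D' ∧ NAE3.HasCompleteness D' c ∧
        ∀ (d : ℕ) (f : (Fin d → ℝ) → ℝ), NAE3.IsRounding f → NAE3.s₃ f D' ≤ NAE3.s₃ f D) ∧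
    (∀ (d : ℕ) (f : (Fin d → ℝ) → ℝ), NAE3.IsRounding f →
      ∃ D : MeasureTheory.Measure (ℝ × ℝ × ℝ), NAE3.IsHardForm D ∧ NAE3.IsHardest f c D) ∧
    (∀ (d : ℕ) (f : (Fin d → ℝ) → ℝ), NAE3.IsRounding f →
      ¬ (f =ᵐ[NAE3.stdGauss d] 0) →
      ∀ D : MeasureTheory.Measure (ℝ × ℝ × ℝ), NAE3.IsHardest f c D →
        ∃ D' : MeasureTheory.Measure (ℝ × ℝ × ℝ), NAE3.IsHardForm D' ∧ NAE3.HasCompleteness D' c ∧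
          ∀ (d' : ℕ) (g : (Fin d' → ℝ) → ℝ), NAE3.IsRounding g →
            NAE3.s₃ g D' = NAE3.s₃ g D) := by
  refine ⟨fun D hD => ?_, fun d f hf => NAE3.exists_isHardest hc hf,
    fun d f hf hne D hD => hD.exists_equivalent hf hne⟩
  obtain ⟨w, -, p, hp, hcomp, hle⟩ := NAE3.exists_hardForm_le hD
  exact ⟨_, NAE3.isHardForm_twoPoint w hp, hcomp, hle⟩
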